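/- Let $k$ be a field and $X$ an integral scheme of finite type over $k$. A compactification of $X$ is an open immersion $\tau\colon X\hookrightarrow\overline X$ of $k$-schemes, with $\overline X$ integral and proper over $k$, such that $\overline X\setminus X$ is the support of an effective Cartier divisor. Let $\square=\mathbb P^1_k\setminus\{1\}$, and let $F_n=\sum_{i=1}^n\{y_i=1\}$ on $(\mathbb P^1)^n$; the faces of $\square^n$ are given by equations $y_i=\epsilon_i$ with $\epsilon_i\in\{0,\infty\}$. For an effective Cartier divisor $D$ on $\overline X$ with support $|D|$ contained in $\overline X\setminus X$ and for $r,n\ge 0$, let $C^r(\overline X|D,n)$ be the set of integral closed subschemes $V\subset X\times\square^n$ of codimension $r$ which intersect $X\times F$ properly for all faces $F$ of $\square^n$ and satisfy the following modulus condition. If $n=0$, the closure of $V$ in $\overline X$ does not meet $D$. If $n>0$, let $\overline V$ be the closure of $V$ in $\overline X\times(\mathbb P^1)^n$ and let $\varphi_V\colon\overline V^N\to\overline X\times(\mathbb P^1)^n$ be the natural map from its normalization; if $\overline V$ meets $D\times(\mathbb P^1)^n$, then $\varphi_V^*(D\times(\mathbb P^1)^n)\le\varphi_V^*(\overline X\times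 F_n)$ as Cartier divisors. Let $z^r(\overline X|D,\bullet)$ be the complex of free abelian groups on the sets $C^r(\overline X|D,n)$ modulo degenerate cycles (those generated by pullbacks of cycles along the projections $X\times\square^n\to X\times\square^{n-1}$ forgetting one coordinate), with boundary $\partial=\sum_{i}(-1)^i(\partial_i^\infty-\partial_i^0)$, where $\partial_i^\epsilon$ is the pullback of cycles to the face $y_i=\epsilon$. Let $z^r(X,\bullet)$ be the complex defined in the same way without the modulus condition, and put $\mathrm{CH}^r(\overline X|D,n)=H_n(z^r(\overline X|D,\bullet))$ and $\mathrm{CH}^r(X,n)=H_n(z^r(X,\bullet))$. (1) Let $X\hookrightarrow\overline X$ and $X\hookrightarrow\overline X'$ be compactifications and let $f\colon\overline X'\to\overline X$ be a proper surjective morphism of $k$-schemes which is the identity on $X$. Let $D$ be an effective Cartier divisor on $\overline X$ with support contained in $\overline X\setminus X$. Then $D'=f^*D$ is an effective Cartier divisor on $\overline X'$ and, for all $r,n\ge0$, $$C^r(\overline X|D,n)=C^r(\overline X'|D',n)$$ as subsets of the set of integral closed subschemes of $X\times\square^n$. (2) For all $r\ge0$ and any two compactifications $\overline X$, $\overline X'$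 of $X$, the pro-complexes $\{z^r(\overline X|D,\bullet)\}_D$ and $\{z^r(\overline X'|D',\bullet)\}_{D'}$, where $D$ and $D'$ range over all effective Cartier divisors with $|D|=\overline X\setminus X$ and $|D'|=\overline X'\setminus X$, are isomorphic, compatibly with the natural maps to $z^r(X,\bullet)$. The same holds, for all $r,n\ge 0$, for the pro-abelian groups $\{\mathrm{CH}^r(\overline X|D,n)\}_D$, and for the higher Chow groups with compact support $\mathrm{CH}^r(X,n)_c=\{\mathrm{CH}^r(\overline X|mD,n)\}_{m\ge1}$ defined by any fixed $D$ with $|D|=\overline X\setminus X$, compatibly with the natural maps to $\mathrm{CH}^r(X,n)$. -/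

import Mathlib

open CategoryTheory CategoryTheory.Limits AlgebraicGeometry TopologicalSpace

universe u

noncomputable section

namespace CycleModulus

/-! ## Integral closed subschemes -/

/-- An integral closed subscheme of `Y`, given by its quasi-coherent ideal sheaf. -/
@[ext]
structure IntegralClosedSubscheme (Y : Scheme.{u}) : Type u where
  ideal : Y.IdealSheafData
  isIntegral : IsIntegral ideal.subscheme

attribute [instance] IntegralClosedSubscheme.isIntegral

lemma isReduced_vanishingIdeal {Y : Scheme.{u}} (Z : Closeds Y) :
    IsReduced (Scheme.IdealSheafData.vanishingIdeal Z).subscheme := by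
  have : ∀ i, IsReduced
      ((Scheme.IdealSheafData.vanishingIdeal Z).subschemeCover.openCover.X i) := by
    intro U
    have : _root_.IsReduced
        (Γ(Y, U.1) ⧸ (Scheme.IdealSheafData.vanishingIdeal Z).ideal U) := by
      rw [← Ideal.isRadical_iff_quotient_reduced]
      exact PrimeSpectrum.isRadical_vanishingIdeal _
    change IsReduced (Spec (.of (Γ(Y, U.1) ⧸ (Scheme.IdealSheafData.vanishingIdeal Z).ideal U)))
    infer_instance
  exact IsReduced.of_openCover _ (Scheme.IdealSheafData.vanishingIdeal Z).subschemeCover.openCover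

lemma isIntegral_vanishingIdeal {Y : Scheme.{u}} (Z : Closeds Y)
    (hZ : IsIrreducible (Z : Set Y)) :
    IsIntegral (Scheme.IdealSheafData.vanishingIdeal Z).subscheme := by
  have := isReduced_vanishingIdeal Z
  have : IrreducibleSpace (Scheme.IdealSheafData.vanishingIdeal Z).subscheme :=
    Subtype.irreducibleSpace hZ
  exact isIntegral_of_irreducibleSpace_of_isReduced _

/-- An irreducible closed subset with its reduced induced scheme structure. -/
def IntegralClosedSubscheme.ofIrreducible {Y : Scheme.{u}} (Z : Closeds Y)
    (hZ : IsIrreducible (Z : Set Y)) : IntegralClosedSubscheme Y :=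
  ⟨Scheme.IdealSheafData.vanishingIdeal Z, isIntegral_vanishingIdeal Z hZ⟩

/-- The integral closed subscheme with generic point `y`. -/
def IntegralClosedSubscheme.ofPoint {Y : Scheme.{u}} (y : Y) : IntegralClosedSubscheme Y :=
  .ofIrreducible (Closeds.closure {y}) isIrreducible_singleton.closure

namespace IntegralClosedSubscheme

variable {Y Y' : Scheme.{u}} (V : IntegralClosedSubscheme Y)

/-- The generic point of an integral closed subscheme, as a point of the ambient scheme. -/
def genericPt : Y := V.ideal.subschemeι (genericPoint V.ideal.subscheme)

lemma isIrreducible_support : IsIrreducible (V.ideal.support : Set Y) := by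
  rw [← Scheme.IdealSheafData.range_subschemeι, ← Set.image_univ]
  exact (IrreducibleSpace.isIrreducible_univ _).image _ V.ideal.subschemeι.continuous.continuousOn

/-- The closure in `Y'` of (the image under `g` of) an integral closed subscheme of `Y`, with its
reduced structure. -/
def closureIn (g : Y ⟶ Y') : IntegralClosedSubscheme Y' :=
  .ofIrreducible (Closeds.closure (g '' (V.ideal.support : Set Y)))
    (V.isIrreducible_support.image _ g.continuous.continuousOn).closure

end IntegralClosedSubscheme

/-- The codimension in `Y` of the irreducible closed subset with generic point `y`. -/
def codim {Y : Scheme.{u}} (y : Y) : WithBot ℕ∞ := ringKrullDim (Y.presheaf.stalk y)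

/-- The generic points of the irreducible components of a closed subset `T`. -/
def componentPts {Y : Scheme.{u}} (T : Set Y) : Set Y :=
  {y | y ∈ T ∧ ∀ z ∈ T, z ⤳ y → z = y}

/-! ## Normalization and Cartier divisors -/

/-- The normalization `W^N ⟶ W` of an integral scheme `W`: the normalization of `W` in (the
spectrum of) its function field. -/
def normalization (W : Scheme.{u}) [IsIntegral W] : Scheme.{u} :=
  (W.fromSpecStalk (genericPoint W)).normalization

/-- The natural map from the normalization. -/
def normalizationMap (W : Scheme.{u}) [IsIntegral W] : normalization W ⟶ W :=
  (W.fromSpecStalk (genericPoint W)).fromNormalization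

/-- A closed subscheme, given by its ideal sheaf, is an effective Cartier divisor if locally
its ideal is generated by one nonzerodivisor. -/
def IsEffectiveCartier {Y : Scheme.{u}} (D : Y.IdealSheafData) : Prop :=
  ∀ y : Y, ∃ U : Y.affineOpens, y ∈ U.1 ∧
    ∃ s ∈ nonZeroDivisors Γ(Y, U), D.ideal U = Ideal.span {s}

lemma IsEffectiveCartier.exists_basicOpen {Y : Scheme.{u}} {D : Y.IdealSheafData}
    {U : Y.affineOpens} {s : Γ(Y, U)} (hs : s ∈ nonZeroDivisors Γ(Y, U))
    (hD : D.ideal U = Ideal.span {s}) (f : Γ(Y, U)) :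
    ∃ t ∈ nonZeroDivisors Γ(Y, Y.affineBasicOpen f),
      D.ideal (Y.affineBasicOpen f) = Ideal.span {t} := by
  let F := Y.presheaf.map (homOfLE (Y.basicOpen_le f)).op
  let : Algebra Γ(Y, U) Γ(Y, Y.affineBasicOpen f) := F.hom.toAlgebra
  have : IsLocalization.Away f Γ(Y, Y.affineBasicOpen f) :=
    U.2.isLocalization_of_eq_basicOpen _ _ rfl
  refine ⟨F.hom s, IsLocalization.map_nonZeroDivisors_le (.powers f) _ ⟨s, hs, rfl⟩, ?_⟩
  rw [← D.map_ideal_basicOpen U f, hD, Ideal.map_span, Set.image_singleton]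
  rfl

/-- The sum of two effective Cartier divisors is an effective Cartier divisor. -/
lemma IsEffectiveCartier.mul {Y : Scheme.{u}} {D E : Y.IdealSheafData}
    (hD : IsEffectiveCartier D) (hE : IsEffectiveCartier E) : IsEffectiveCartier (D * E) := by
  intro y
  obtain ⟨U, hyU, s, hs, hDs⟩ := hD y
  obtain ⟨V, hyV, t, ht, hEt⟩ := hE y
  obtain ⟨f, g, hfg, hyf⟩ := exists_basicOpen_le_affine_inter U.2 V.2 y ⟨hyU, hyV⟩
  obtain ⟨s', hs', hDs'⟩ := IsEffectiveCartier.exists_basicOpen hs hDs f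
  have hE' := IsEffectiveCartier.exists_basicOpen ht hEt g
  rw [show Y.affineBasicOpen g = Y.affineBasicOpen f from Subtype.ext hfg.symm] at hE'
  obtain ⟨t', ht', hEt'⟩ := hE'
  refine ⟨Y.affineBasicOpen f, hyf, s' * t', mul_mem hs' ht', ?_⟩
  rw [Scheme.IdealSheafData.ideal_mul, Pi.mul_apply, hDs', hEt',
    Ideal.span_singleton_mul_span_singleton]

lemma IsEffectiveCartier.pow {Y : Scheme.{u}} {D : Y.IdealSheafData}
    (hD : IsEffectiveCartier D) (m : ℕ) : IsEffectiveCartier (D ^ (m + 1)) := by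
  induction m with
  | zero => simpa using hD
  | succ m ih => rw [pow_succ]; exact ih.mul hD

/-! ## The projective line, the cube and its faces -/

section Cube

variable (k : Type u) [Field k]

/-- The spectrum of the base field. -/
abbrev base : Scheme.{u} := Spec (.of k)

/-- The standard grading of `k[Y₀, Y₁]`. -/
abbrev grading : ℕ → Submodule k (MvPolynomial (Fin 2) k) :=
  MvPolynomial.homogeneousSubmodule (Fin 2) k

instance : GradedAlgebra (grading k) := MvPolynomial.gradedAlgebra

/-- The projective line `Proj k[Y₀, Y₁]` over `k`. -/
abbrev P1 : Over (base k) :=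
  Over.mk (Proj.toSpecZero (grading k) ≫
    Spec.map (CommRingCat.ofHom (algebraMap k (grading k 0))))

/-- Evaluation of polynomials at a point of `k²`. -/
def evalAt (c : Fin 2 → k) : MvPolynomial (Fin 2) k →+* Γ(base k, ⊤) :=
  (Scheme.ΓSpecIso (.of k)).inv.hom.comp (MvPolynomial.eval c)

lemma evalAt_irrelevant (c : Fin 2 → k) (hc : c ≠ 0) :
    (HomogeneousIdeal.irrelevant (grading k)).toIdeal.map (evalAt k c) = ⊤ := by
  obtain ⟨i, hi⟩ := Function.ne_iff.mp hc
  refine Ideal.eq_top_of_isUnit_mem _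
    (Ideal.mem_map_of_mem (evalAt k c) (x := MvPolynomial.X i) ?_) ?_
  · refine (HomogeneousIdeal.mem_irrelevant_iff _ _).mpr ?_
    rw [GradedRing.proj_apply, DirectSum.decompose_of_mem_ne (grading k) (i := 1)
      (MvPolynomial.isHomogeneous_X k i) (by simp)]
  · have : IsUnit (MvPolynomial.eval c (MvPolynomial.X i)) := by simpa using hi
    exact this.map (Scheme.ΓSpecIso (.of k)).inv.hom

/-- The `k`-rational point `[c₀ : c₁]` of the projective line. -/
def P1.point (c : Fin 2 → k) (hc : c ≠ 0) : Over.mk (𝟙 (base k)) ⟶ P1 k :=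
  Over.homMk (Proj.fromOfGlobalSections (grading k) (evalAt k c) (evalAt_irrelevant k c hc)) (by
    simp only [Over.mk_hom]
    rw [Proj.fromOfGlobalSections_toSpecZero_assoc, ← Spec.map_comp, ← CommRingCat.ofHom_comp]
    have : ((evalAt k c).comp (algebraMap (grading k 0) (MvPolynomial (Fin 2) k))).comp
        (algebraMap k (grading k 0)) = (Scheme.ΓSpecIso (.of k)).inv.hom := by
      ext x
      change evalAt k c (algebraMap k (MvPolynomial (Fin 2) k) x) = _
      simp [evalAt, MvPolynomial.algebraMap_eq]
    rw [this]
    simp)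

/-- The complement of the point `1` in the projective line, where the coordinate is
`y = Y₁ / Y₀`. -/
def boxOpen : (Proj (grading k)).Opens :=
  Proj.basicOpen (grading k) (MvPolynomial.X 1 - MvPolynomial.X 0)

/-- `□ = ℙ¹ ∖ {1}`. -/
abbrev box : Over (base k) := Over.mk ((boxOpen k).ι ≫ (P1 k).hom)

/-- The inclusion `□ ⟶ ℙ¹`. -/
def boxι : box k ⟶ P1 k := Over.homMk (boxOpen k).ι

lemma range_point_subset (c : Fin 2 → k) (hc : c ≠ 0) (hc' : c 1 - c 0 ≠ 0) :
    Set.range (P1.point k c hc).left ⊆ Set.range (boxOpen k).ι := by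
  have h : MvPolynomial.X 1 - MvPolynomial.X 0 ∈ grading k 1 :=
    sub_mem (MvPolynomial.isHomogeneous_X k 1) (MvPolynomial.isHomogeneous_X k 0)
  have h1 := Proj.fromOfGlobalSections_preimage_basicOpen (grading k) (evalAt k c)
    (evalAt_irrelevant k c hc) one_pos h
  have h2 : IsUnit (evalAt k c (MvPolynomial.X 1 - MvPolynomial.X 0)) := by
    have : IsUnit (MvPolynomial.eval c (MvPolynomial.X 1 - MvPolynomial.X 0)) := by
      simpa using hc'
    exact this.map (Scheme.ΓSpecIso (.of k)).inv.hom
  rw [Scheme.basicOpen_of_isUnit _ h2] at h1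
  rintro _ ⟨x, rfl⟩
  rw [Scheme.Opens.range_ι]
  exact h1.ge (Set.mem_univ x : x ∈ (⊤ : (base k).Opens))

/-- The `k`-rational point `[c₀ : c₁]` of `□`. -/
def box.point (c : Fin 2 → k) (hc : c ≠ 0) (hc' : c 1 - c 0 ≠ 0) :
    Over.mk (𝟙 (base k)) ⟶ box k :=
  Over.homMk (IsOpenImmersion.lift (boxOpen k).ι (P1.point k c hc).left
    (range_point_subset k c hc hc')) (by
      have := Over.w (P1.point k c hc)
      simp only [Over.mk_hom] at this ⊢
      rw [IsOpenImmersion.lift_fac_assoc]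
      exact this)

/-- The points `0` (for `false`) and `∞` (for `true`) of `□`. -/
def box.vertex : Bool → (Over.mk (𝟙 (base k)) ⟶ box k)
  | false => box.point k ![1, 0] (by simp) (by simp)
  | true => box.point k ![0, 1] (by simp) (by simp)

variable {k}

/-- `Y × Pⁿ` over `k`. -/
abbrev cubeProd (Y P : Over (base k)) (n : ℕ) : Over (base k) := Y ⨯ ∏ᶜ fun _ : Fin n => P

/-- The `i`-th coordinate `Y × Pⁿ ⟶ P`. -/
def coord (Y P : Over (base k)) (n : ℕ) (i : Fin n) : cubeProd Y P n ⟶ P :=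
  prod.snd ≫ Pi.π (fun _ : Fin n => P) i

/-- `Y × Pⁿ ⟶ Y' × P'ⁿ` induced by `Y ⟶ Y'` and `P ⟶ P'`. -/
def cubeMap {Y Y' P P' : Over (base k)} (f : Y ⟶ Y') (g : P ⟶ P') (n : ℕ) :
    cubeProd Y P n ⟶ cubeProd Y' P' n :=
  prod.map f (Limits.Pi.map fun _ => g)

/-- The inclusion of the codimension one face `t_i = ε` of `Y × □ⁿ⁺¹`. -/
def faceMap (Y : Over (base k)) (n : ℕ) (i : Fin (n + 1)) (ε : Bool) :
    cubeProd Y (box k) n ⟶ cubeProd Y (box k) (n + 1) :=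
  prod.lift prod.fst (Pi.lift (i.insertNth (α := fun _ => cubeProd Y (box k) n ⟶ box k)
    (Over.homMk (cubeProd Y (box k) n).hom ≫ box.vertex k ε) (coord Y (box k) n)))

/-- The projection `Y × □ⁿ⁺¹ ⟶ Y × □ⁿ` forgetting the `i`-th coordinate. -/
def degeneracyMap (Y : Over (base k)) (n : ℕ) (i : Fin (n + 1)) :
    cubeProd Y (box k) (n + 1) ⟶ cubeProd Y (box k) n :=
  prod.lift prod.fst (Pi.lift fun j => coord Y (box k) (n + 1) (i.succAbove j))

/-- The closed subset `Y × F` of `Y × □ⁿ`, where `F` is the face given by the equations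
`t_i = ε_i` for `i ∈ s`. -/
def faceSet (Y : Over (base k)) (n : ℕ) (s : Finset (Fin n)) (ε : Fin n → Bool) :
    Set (cubeProd Y (box k) n).left :=
  {y | ∀ i ∈ s, (coord Y (box k) n i).left y ∈ Set.range (box.vertex k (ε i)).left}

/-- The divisor `Y × F_n = ∑ᵢ {y_i = 1}` of `Y × (ℙ¹)ⁿ`. -/
def divisorAtOne (Y : Over (base k)) (n : ℕ) : (cubeProd Y (P1 k) n).left.IdealSheafData :=
  ∏ i : Fin n, (P1.point k ![1, 1] (by simp)).left.ker.comap (coord Y (P1 k) n i).left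

/-- The divisor `D × (ℙ¹)ⁿ` of `Y × (ℙ¹)ⁿ`. -/
def divisorTimes (Y : Over (base k)) (D : Y.left.IdealSheafData) (n : ℕ) :
    (cubeProd Y (P1 k) n).left.IdealSheafData :=
  D.comap (prod.fst : cubeProd Y (P1 k) n ⟶ Y).left

/-! ## Cycles with modulus -/

/-- `V ⊆ Y × □ⁿ` meets `Y × F` properly for all faces `F` of `□ⁿ`: every irreducible component of
`V ∩ (Y × F)` has codimension `codim V + codim F` in `Y × □ⁿ`. -/
def MeetsFacesProperly {Y : Over (base k)} {n : ℕ}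
    (V : IntegralClosedSubscheme (cubeProd Y (box k) n).left) : Prop :=
  ∀ (s : Finset (Fin n)) (ε : Fin n → Bool),
    ∀ y ∈ componentPts ((V.ideal.support : Set _) ∩ faceSet Y n s ε),
      codim y = codim V.genericPt + (s.card : WithBot ℕ∞)

/-- The integral closed subschemes of codimension `r` of `X × □ⁿ` in good position with respect
to the faces. -/
def admissibleCycles (X : Over (base k)) (r n : ℕ) :
    Set (IntegralClosedSubscheme (cubeProd X (box k) n).left) :=
  {V | codim V.genericPt = (r : WithBot ℕ∞) ∧ MeetsFacesProperly V}

/-- The closure of `V ⊆ X × □ⁿ` in `X̄ × (ℙ¹)ⁿ`, where `j : X ⟶ X̄`. -/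
def closureInP1 {X Xbar : Over (base k)} (j : X ⟶ Xbar) {n : ℕ}
    (V : IntegralClosedSubscheme (cubeProd X (box k) n).left) :
    IntegralClosedSubscheme (cubeProd Xbar (P1 k) n).left :=
  V.closureIn (cubeMap j (boxι k) n).left

/-- The natural map from the normalization of the closure of `V` to `X̄ × (ℙ¹)ⁿ`. -/
def normalizedClosureMap {X Xbar : Over (base k)} (j : X ⟶ Xbar) {n : ℕ}
    (V : IntegralClosedSubscheme (cubeProd X (box k) n).left) :
    normalization (closureInP1 j V).ideal.subscheme ⟶ (cubeProd Xbar (P1 k) n).left :=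
  normalizationMap _ ≫ (closureInP1 j V).ideal.subschemeι

/-- The set `C^r(X̄|D, n)` as a set of integral closed subschemes of `X × □ⁿ`, where
`j : X ⟶ X̄` is the inclusion of (an open subscheme of) the complement of `D`.
An inequality `E ≤ E'` of effective Cartier divisors is the inclusion of the ideal of `E'`
in the ideal of `E`. For `n = 0`, `X × □⁰ = X` and `X̄ × (ℙ¹)⁰ = X̄`. -/
def modulusCycles {X Xbar : Over (base k)} (j : X ⟶ Xbar) (D : Xbar.left.IdealSheafData)
    (r n : ℕ) : Set (IntegralClosedSubscheme (cubeProd X (box k) n).left) :=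
  {V | V ∈ admissibleCycles X r n ∧
    (n = 0 → Disjoint ((closureInP1 j V).ideal.support : Set (cubeProd Xbar (P1 k) n).left)
      (divisorTimes Xbar D n).support) ∧
    (0 < n → (((closureInP1 j V).ideal.support : Set (cubeProd Xbar (P1 k) n).left) ∩
        (divisorTimes Xbar D n).support).Nonempty →
      (divisorAtOne Xbar n).comap (normalizedClosureMap j V) ≤
        (divisorTimes Xbar D n).comap (normalizedClosureMap j V))}

lemma modulusCycles_subset {X Xbar : Over (base k)} (j : X ⟶ Xbar)
    (D : Xbar.left.IdealSheafData) (r n : ℕ) :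
    modulusCycles j D r n ⊆ admissibleCycles X r n := fun _ h => h.1

/-- The modulus condition gets weaker when the divisor gets smaller. -/
lemma modulusCycles_mono {X Xbar : Over (base k)} (j : X ⟶ Xbar)
    {D E : Xbar.left.IdealSheafData} (h : D ≤ E) (r n : ℕ) :
    modulusCycles j D r n ⊆ modulusCycles j E r n := by
  have h1 : divisorTimes Xbar D n ≤ divisorTimes Xbar E n :=
    Scheme.IdealSheafData.comap_mono _ h
  have h2 : ((divisorTimes Xbar E n).support : Set (cubeProd Xbar (P1 k) n).left) ⊆
      (divisorTimes Xbar D n).support := Scheme.IdealSheafData.support_antitone h1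
  rintro V ⟨hV, h0, hn⟩
  exact ⟨hV, fun e => (h0 e).mono_right h2, fun e hne =>
    (hn e (hne.mono (Set.inter_subset_inter_right _ h2))).trans
      (Scheme.IdealSheafData.comap_mono _ h1)⟩

end Cube

/-! ## The complexes -/

/-- The cycle `∑_Z length(𝒪_{W, Z}) [Z]` of a closed subscheme `W`, the sum being over the
(generic points of the) irreducible components of `W`. -/
def fundamentalCycle {Y : Scheme.{u}} (W : Y.IdealSheafData) : IntegralClosedSubscheme Y →₀ ℤ :=
  ∑ᶠ z ∈ componentPts (Set.univ : Set W.subscheme),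
    Finsupp.single (IntegralClosedSubscheme.ofPoint (W.subschemeι z))
      ((Module.length (W.subscheme.presheaf.stalk z) (W.subscheme.presheaf.stalk z)).toNat : ℤ)

/-- Pullback of cycles, sending an integral closed subscheme `V` to the cycle of its scheme
theoretic inverse image. It is only used for flat projections, and for inclusions of faces
`t = ε` on cycles not contained in the face, where it is the intersection with the Cartier
divisor `t = ε`. -/
def cyclePullback {Y Y' : Scheme.{u}} (g : Y' ⟶ Y) :
    (IntegralClosedSubscheme Y →₀ ℤ) →+ (IntegralClosedSubscheme Y' →₀ ℤ) :=
  Finsupp.liftAddHom fun V => (zmultiplesHom _ (fundamentalCycle (V.ideal.comap g)))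

section Subquotient

variable {A : ℕ → Type u} [∀ n, AddCommGroup (A n)] (d : ∀ n, A (n + 1) →+ A n)

/-- The largest graded subgroup of `B` that is stable under `d` and on which `d ∘ d = 0`, that is,
the largest subcomplex contained in `B`. If `d` restricts to `B` and makes it a complex, as for the
groups of admissible cycles below, it is `B` itself. -/
def largestSubcomplex (B : ∀ n, AddSubgroup (A n)) : ∀ n, AddSubgroup (A n)
  | 0 => B 0
  | 1 => B 1 ⊓ (B 0).comap (d 0)
  | n + 2 => B (n + 2) ⊓ (largestSubcomplex B (n + 1)).comap (d (n + 1)) ⊓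
      ((d n).comp (d (n + 1))).ker

lemma largestSubcomplex_mono {B B' : ∀ n, AddSubgroup (A n)} (h : ∀ n, B n ≤ B' n) :
    ∀ n, largestSubcomplex d B n ≤ largestSubcomplex d B' n
  | 0 => h 0
  | 1 => inf_le_inf (h 1) (AddSubgroup.comap_mono (h 0))
  | n + 2 => inf_le_inf_right _ (inf_le_inf (h _)
      (AddSubgroup.comap_mono (largestSubcomplex_mono h (n + 1))))

lemma largestSubcomplex_le (B : ∀ n, AddSubgroup (A n)) :
    ∀ n, largestSubcomplex d B n ≤ B n
  | 0 => le_rfl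
  | 1 => inf_le_left
  | _ + 2 => inf_le_left.trans inf_le_left

lemma largestSubcomplex_map (B : ∀ n, AddSubgroup (A n)) :
    ∀ n, largestSubcomplex d B (n + 1) ≤ (largestSubcomplex d B n).comap (d n)
  | 0 => inf_le_right
  | _ + 1 => inf_le_left.trans inf_le_right

lemma largestSubcomplex_sq (B : ∀ n, AddSubgroup (A n)) (n : ℕ) (x : A (n + 2))
    (hx : x ∈ largestSubcomplex d B (n + 2)) : d n (d (n + 1) x) = 0 := hx.2

/-- The degree `n` part of the complex `B / N`. -/
abbrev subquotientObj (B N : ∀ n, AddSubgroup (A n)) (n : ℕ) : AddCommGrpCat.{u} :=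
  AddCommGrpCat.of (largestSubcomplex d B n ⧸
    (largestSubcomplex d (fun m => N m ⊓ B m) n).addSubgroupOf (largestSubcomplex d B n))

/-- The differential of the complex `B / N`. -/
def subquotientD (B N : ∀ n, AddSubgroup (A n)) (n : ℕ) :
    subquotientObj d B N (n + 1) ⟶ subquotientObj d B N n :=
  AddCommGrpCat.ofHom (QuotientAddGroup.map _ _
    (((d n).comp (AddSubgroup.subtype _)).codRestrict (largestSubcomplex d B n)
      fun x => largestSubcomplex_map d B n x.2)
    fun _ hx => largestSubcomplex_map d (fun m => N m ⊓ B m) n hx)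

/-- The complex `B / N`, where `N` is a graded subgroup of `B`. -/
def subquotient (B N : ∀ n, AddSubgroup (A n)) : ChainComplex AddCommGrpCat.{u} ℕ :=
  ChainComplex.of (subquotientObj d B N) (subquotientD d B N) (fun n => by
    ext x
    refine (QuotientAddGroup.eq_zero_iff _).mpr ?_
    change d n (d (n + 1) x.1) ∈ largestSubcomplex d (fun m => N m ⊓ B m) n
    exact (largestSubcomplex_sq d B n x.1 x.2).symm ▸
      AddSubgroup.zero_mem (largestSubcomplex d (fun m => N m ⊓ B m) n))

/-- The map between subquotients induced by inclusions. -/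
def subquotientMap {B N B' N' : ∀ n, AddSubgroup (A n)} (hB : ∀ n, B n ≤ B' n)
    (hN : ∀ n, N n ≤ N' n) : subquotient d B N ⟶ subquotient d B' N' :=
  ChainComplex.ofHom
    (fun n => (AddCommGrpCat.ofHom (QuotientAddGroup.map _ _
      (AddSubgroup.inclusion (largestSubcomplex_mono d hB n))
      fun _ hx => largestSubcomplex_mono d (fun m => inf_le_inf (hN m) (hB m)) n hx) :
        subquotientObj d B N n ⟶ subquotientObj d B' N' n))
    (fun n => by
      simp only [subquotient, ChainComplex.of_d]
      ext x
      rfl)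

lemma subquotientMap_id (B N : ∀ n, AddSubgroup (A n)) :
    subquotientMap d (fun n => le_refl (B n)) (fun n => le_refl (N n)) = 𝟙 _ := by
  apply HomologicalComplex.hom_ext
  intro n
  refine AddCommGrpCat.hom_ext (AddMonoidHom.ext fun x => ?_)
  obtain ⟨x, rfl⟩ := QuotientAddGroup.mk_surjective x
  rfl

lemma subquotientMap_comp {B N B' N' B'' N'' : ∀ n, AddSubgroup (A n)} (hB : ∀ n, B n ≤ B' n)
    (hN : ∀ n, N n ≤ N' n) (hB' : ∀ n, B' n ≤ B'' n) (hN' : ∀ n, N' n ≤ N'' n) :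
    subquotientMap d hB hN ≫ subquotientMap d hB' hN' =
      subquotientMap d (fun n => (hB n).trans (hB' n)) (fun n => (hN n).trans (hN' n)) := by
  apply HomologicalComplex.hom_ext
  intro n
  refine AddCommGrpCat.hom_ext (AddMonoidHom.ext fun x => ?_)
  obtain ⟨x, rfl⟩ := QuotientAddGroup.mk_surjective x
  rfl

end Subquotient

section CycleComplex

variable {k : Type u} [Field k] (X : Over (base k))

/-- The group of all cycles on `X × □ⁿ`. -/
abbrev cycles (n : ℕ) : Type u := IntegralClosedSubscheme (cubeProd X (box k) n).left →₀ ℤ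

/-- `∂ = ∑_{1 ≤ i ≤ n + 1} (-1)^i (∂_i^∞ - ∂_i^0)`. -/
def boundary (n : ℕ) : cycles X (n + 1) →+ cycles X n :=
  ∑ i : Fin (n + 1), (-1 : ℤ) ^ (i.val + 1) •
    (cyclePullback (faceMap X n i true).left - cyclePullback (faceMap X n i false).left)

variable {X}
variable (C : ∀ n, Set (IntegralClosedSubscheme (cubeProd X (box k) n).left))

/-- The free abelian group on the set `C n`. -/
def cycleGroup (n : ℕ) : AddSubgroup (cycles X n) :=
  (Finsupp.supported ℤ ℤ (C n)).toAddSubgroup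

/-- The degenerate cycles: sums of pullbacks of cycles along the projections
`X × □ⁿ⁺¹ ⟶ X × □ⁿ`. -/
def degenerateGroup : ∀ n, AddSubgroup (cycles X n)
  | 0 => ⊥
  | n + 1 => ⨆ i : Fin (n + 1),
      (cycleGroup C n).map (cyclePullback (degeneracyMap X n i).left)

/-- The non-degenerate complex associated with the cubical group `n ↦ cycleGroup C n`. -/
def cycleComplex : ChainComplex AddCommGrpCat.{u} ℕ :=
  subquotient (boundary X) (cycleGroup C) (degenerateGroup C)

variable {C}
variable {C' C'' : ∀ n, Set (IntegralClosedSubscheme (cubeProd X (box k) n).left)}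

lemma cycleGroup_mono (h : ∀ n, C n ⊆ C' n) (n : ℕ) : cycleGroup C n ≤ cycleGroup C' n :=
  (Finsupp.supported_mono (M := ℤ) (R := ℤ) (h n) :)

lemma degenerateGroup_mono (h : ∀ n, C n ⊆ C' n) :
    ∀ n, degenerateGroup C n ≤ degenerateGroup C' n
  | 0 => le_rfl
  | n + 1 => iSup_mono fun _ => AddSubgroup.map_mono (cycleGroup_mono h n)

/-- The map of complexes induced by inclusions `C n ⊆ C' n`. -/
def cycleComplexMap (h : ∀ n, C n ⊆ C' n) : cycleComplex C ⟶ cycleComplex C' :=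
  subquotientMap _ (cycleGroup_mono h) (degenerateGroup_mono h)

lemma cycleComplexMap_id : cycleComplexMap (fun n => subset_refl (C n)) = 𝟙 _ :=
  subquotientMap_id _ _ _

lemma cycleComplexMap_comp (h : ∀ n, C n ⊆ C' n) (h' : ∀ n, C' n ⊆ C'' n) :
    cycleComplexMap h ≫ cycleComplexMap h' = cycleComplexMap fun n => (h n).trans (h' n) :=
  subquotientMap_comp _ _ _ _ _

variable (X)

/-- Bloch's cubical cycle complex `z^r(X, •)`. -/
def blochComplex (r : ℕ) : ChainComplex AddCommGrpCat.{u} ℕ :=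
  cycleComplex (admissibleCycles X r)

variable {X}

/-- The cycle complex with modulus `z^r(X̄|D, •)`. For cycles in `C^r(X̄|D, n)` all faces have
components in `C^r(X̄|D, n - 1)` and `∂ ∘ ∂ = 0`, so `z^r(X̄|D, n)` is the quotient of the free
abelian group on `C^r(X̄|D, n)` by the degenerate cycles. -/
def modulusComplex {Xbar : Over (base k)} (j : X ⟶ Xbar) (D : Xbar.left.IdealSheafData) (r : ℕ) :
    ChainComplex AddCommGrpCat.{u} ℕ :=
  cycleComplex (modulusCycles j D r)

end CycleComplex

/-! ## Compactifications and pro-systems -/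

section Pro

/-- The pro-objects of `C`. -/
abbrev Pro (C : Type*) [Category C] := (Ind Cᵒᵖ)ᵒᵖ

variable {C : Type (u + 1)} [Category.{u} C] {J : Type u} [SmallCategory J] [IsCofiltered J]

/-- The pro-object `{F j}_j` of a cofiltered system `F`. -/
def proSystem (F : J ⥤ C) : Pro C := Opposite.op ((Ind.lim Jᵒᵖ).obj F.op)

/-- The constant pro-object. -/
def proConst (Z : C) : Pro C := Opposite.op (Ind.yoneda.obj (Opposite.op Z))

/-- The morphism of pro-objects `{F j}_j ⟶ Z` given by compatible morphisms `F j ⟶ Z`; it is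
represented by `F j ⟶ Z` for any `j`. -/
def proSystemToConst {F : J ⥤ C} {Z : C} (α : F ⟶ (Functor.const J).obj Z) :
    proSystem F ⟶ proConst Z :=
  have := IsCofiltered.nonempty (C := J)
  let j : J := Classical.arbitrary J
  Quiver.Hom.op (Ind.yoneda.map (α.app j).op ≫ colimit.ι (F.op ⋙ Ind.yoneda) (Opposite.op j))

/-- Two cofiltered systems over `Z` define isomorphic pro-objects, compatibly with the maps
to `Z`. -/
def ProIsoOver {J' : Type u} [SmallCategory J'] [IsCofiltered J'] {Z : C}
    {F : J ⥤ C} (α : F ⟶ (Functor.const J).obj Z)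
    {G : J' ⥤ C} (β : G ⟶ (Functor.const J').obj Z) : Prop :=
  ∃ e : proSystem F ≅ proSystem G, e.hom ≫ proSystemToConst β = proSystemToConst α

/-- The system `{H (F j)}_j` over `H Z` obtained by applying a functor `H`. -/
def mapToConst {C' : Type (u + 1)} [Category.{u} C'] (H : C ⥤ C') {F : J ⥤ C} {Z : C}
    (α : F ⟶ (Functor.const J).obj Z) : F ⋙ H ⟶ (Functor.const J).obj (H.obj Z) where
  app j := H.map (α.app j)
  naturality i j f := by
    have h : F.map f ≫ α.app j = α.app i :=
      (α.naturality f).trans (Category.comp_id (α.app i))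
    exact ((H.map_comp _ _).symm.trans (congrArg H.map h)).trans (Category.comp_id _).symm

/-- The system over `Z` obtained by reindexing. -/
def reindexToConst {J' : Type u} [SmallCategory J'] (G : J' ⥤ J) {F : J ⥤ C} {Z : C}
    (α : F ⟶ (Functor.const J).obj Z) : G ⋙ F ⟶ (Functor.const J').obj Z where
  app j := α.app (G.obj j)
  naturality _ _ f := α.naturality (G.map f)

end Pro

section Compactification

variable {k : Type u} [Field k]

/-- A compactification `τ : X ⟶ X̄` over `k` whose boundary is the support of an effective
Cartier divisor. -/
structure Compactification (X : Over (base k)) where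
  Xbar : Over (base k)
  τ : X ⟶ Xbar
  isIntegral : IsIntegral Xbar.left
  isProper : IsProper Xbar.hom
  isOpenImmersion : IsOpenImmersion τ.left
  exists_divisor : ∃ D : Xbar.left.IdealSheafData, IsEffectiveCartier D ∧
    (D.support : Set Xbar.left) = (Set.range τ.left)ᶜ

variable {X : Over (base k)} (K : Compactification X)

/-- The effective Cartier divisors `D` on `X̄` with `|D| = X̄ - X`, ordered by inclusion of ideal
sheaves. -/
abbrev Compactification.Divisor : Type u :=
  {D : K.Xbar.left.IdealSheafData // IsEffectiveCartier D ∧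
    (D.support : Set K.Xbar.left) = (Set.range K.τ.left)ᶜ}

instance : Nonempty K.Divisor := let ⟨D, h⟩ := K.exists_divisor; ⟨⟨D, h⟩⟩

instance : IsCodirectedOrder K.Divisor where
  directed D E := ⟨⟨D.1 * E.1, D.2.1.mul E.2.1, by
    rw [Scheme.IdealSheafData.support_mul, Closeds.coe_sup, D.2.2, E.2.2, Set.union_self]⟩,
    show D.1 * E.1 ≤ D.1 from mul_le_of_le_one_right' le_top,
    show D.1 * E.1 ≤ E.1 from mul_le_of_le_one_left' le_top⟩

/-- The pro-system of complexes `{z^r(X̄|D, •)}_D`. -/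
def modulusSystem (r : ℕ) : K.Divisor ⥤ ChainComplex AddCommGrpCat.{u} ℕ where
  obj D := modulusComplex K.τ D.1 r
  map f := cycleComplexMap (modulusCycles_mono K.τ (leOfHom f) r)
  map_id _ := cycleComplexMap_id
  map_comp _ _ := (cycleComplexMap_comp _ _).symm

/-- The inclusions `z^r(X̄|D, •) ⟶ z^r(X, •)`. -/
def modulusSystemToBloch (r : ℕ) :
    modulusSystem K r ⟶ (Functor.const K.Divisor).obj (blochComplex X r) where
  app D := cycleComplexMap (modulusCycles_subset K.τ D.1 r)
  naturality _ E f := (cycleComplexMap_comp (modulusCycles_mono K.τ (leOfHom f) r)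
    (modulusCycles_subset K.τ E.1 r)).trans (Category.comp_id _).symm

/-- The pro-system of higher Chow groups with modulus `{CH^r(X̄|D, n)}_D`, mapping to Bloch's
higher Chow group `CH^r(X, n)`. -/
def chowSystemToBloch (r n : ℕ) :
    modulusSystem K r ⋙ HomologicalComplex.homologyFunctor AddCommGrpCat.{u} _ n ⟶
      (Functor.const K.Divisor).obj ((blochComplex X r).homology n) :=
  mapToConst (HomologicalComplex.homologyFunctor AddCommGrpCat.{u} (ComplexShape.down ℕ) n)
    (modulusSystemToBloch K r)

/-- The indexing `m ↦ m D`, `m ≥ 1`. -/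
def multiples (D : K.Divisor) : (ULift.{u} ℕ)ᵒᵖ ⥤ K.Divisor where
  obj m := ⟨D.1 ^ (m.unop.down + 1), D.2.1.pow _, by
    rw [Scheme.IdealSheafData.support_pow_succ, D.2.2]⟩
  map f := homOfLE (show D.1 ^ _ ≤ D.1 ^ _ from
    pow_le_pow_right_of_le_one' le_top (Nat.succ_le_succ (ULift.down_le.mpr (leOfHom f.unop))))

/-- The higher Chow group with compact support `CH^r(X, n)_c = {CH^r(X̄|mD, n)}_m`, `m ≥ 1`, as a
pro-system mapping to `CH^r(X, n)`. -/
def chowCompactToBloch (D : K.Divisor) (r n : ℕ) :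
    multiples K D ⋙ modulusSystem K r ⋙
        HomologicalComplex.homologyFunctor AddCommGrpCat.{u} _ n ⟶
      (Functor.const (ULift.{u} ℕ)ᵒᵖ).obj ((blochComplex X r).homology n) :=
  reindexToConst (multiples K D) (chowSystemToBloch K r n)

end Compactification

end CycleModulus

end

/-! Everything is compared inside the fixed set of integral closed subschemes of `X × □ⁿ`. For (1),
let `F` be the base change of `f` to the products with `(ℙ¹)ⁿ`. It is universally closed, so it maps
the closure `W'` of `V` upstairs onto the closure `W` downstairs. Hence `W` meets `D × (ℙ¹)ⁿ`
exactly when `W'` meets its pullback.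

The divisor inequality passes from `W` to `W'` because normalization is functorial for dominant maps
(`exists_normalization_lift`). The converse is the heart of the proof (`comap_normalizationMap_le`).
Over an affine open `U` of `W`, let `d` be an equation of `D` and `g` a section of the ideal of the
divisor at `1`. The inequality upstairs says that `g / d` is a regular function on the preimage of
`U` in the normalization of `W'`. That preimage is universally closed over `U`, so its functions are
integral over `Γ(W, U)`. Thus `g / d`, read in the function field of `W`, lies in the integral
closure of `Γ(W, U)`, which is the ring of the normalization over `U`. Neither birationality nor
finiteness is needed.

For (2), the closure of the diagonal copy of `X` in `X̄ × X̄'` is a compactification dominating both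
(`exists_dominating`). The two boundary divisors pulled back to it have the same support, so by
quasi-compactness a multiple of one bounds the other. By (1) this gives `C(X̄'|mD') ⊆ C(X̄|D)`
(`exists_modulusCycles_pow_subset`), and symmetrically. The systems of sets are therefore mutually
cofinal. Complexes and homology groups are functors of these sets, so the pro-objects agree over the
value at all admissible cycles (`proIsoOver_of_cofinal`). -/

namespace CycleModulus

/-! ### Inverse images of ideal sheaves on affine opens, and their multiplicativity. -/

section IdealSheaf

variable {Y Z : Scheme.{u}}

/-- Both inclusions come from the adjunction between `comap` and `map`; for `≤` it is tested against
the ideal sheaf generated by the extended ideal. -/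
lemma ideal_comap_top_of_isAffine [IsAffine Y] [IsAffine Z] (I : Z.IdealSheafData) (f : Y ⟶ Z) :
    (I.comap f).ideal ⟨⊤, isAffineOpen_top Y⟩ =
      (I.ideal ⟨⊤, isAffineOpen_top Z⟩).map f.appTop.hom := by
  apply le_antisymm
  · have h : I.comap f ≤ .ofIdealTop ((I.ideal ⟨⊤, isAffineOpen_top Z⟩).map f.appTop.hom) := by
      rw [← Scheme.IdealSheafData.le_map_iff_comap_le]
      refine Scheme.IdealSheafData.le_of_isAffine ?_
      rw [Scheme.IdealSheafData.ideal_map_of_isAffineHom, ← Ideal.map_le_iff_le_comap]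
      change _ ≤ Ideal.map _ _
      -- Over `⊤`, `ofIdealTop` is an extension along the restriction from `⊤` to `⊤`, which is the
      -- identity.
      refine Ideal.le_map_of_comap_le_of_surjective _ ?_ ?_
      · intro x
        exact ⟨x, by erw [CategoryTheory.Functor.map_id]; rfl⟩
      · intro x hx
        erw [CategoryTheory.Functor.map_id] at hx
        exact hx
    refine (h _).trans ?_
    change Ideal.map _ _ ≤ _
    rw [Ideal.map_le_iff_le_comap]
    intro x hx
    rw [Ideal.mem_comap]
    erw [CategoryTheory.Functor.map_id]
    exact hx
  · have h := (I.le_map_comap f) ⟨⊤, isAffineOpen_top Z⟩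
    rw [Scheme.IdealSheafData.ideal_map_of_isAffineHom, ← Ideal.map_le_iff_le_comap] at h
    exact h

lemma ideal_comap_ι_top (I : Z.IdealSheafData) (U : Z.affineOpens)
    [IsAffine U.1.toScheme] :
    (I.comap U.1.ι).ideal ⟨⊤, isAffineOpen_top U.1.toScheme⟩ =
      (I.ideal U).map (U.1.ι.appLE U.1 ⊤ (by simp)).hom := by
  rw [Scheme.IdealSheafData.ideal_comap_of_isOpenImmersion]
  have h : U.1.ι ''ᵁ ⊤ ≤ U.1 := by simp
  rw [← I.map_ideal' (U := ⟨U.1.ι ''ᵁ ⊤, (isAffineOpen_top U.1.toScheme).image_of_isOpenImmersion _⟩)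
    (V := U) (homOfLE h).op]
  rw [Scheme.Opens.ι_appIso]
  rw [Scheme.Opens.ι_appLE]
  exact Ideal.comap_id _

instance isIso_ι_appLE (U : Z.Opens) : IsIso (U.ι.appLE U ⊤ (by simp)) := by
  rw [Scheme.Opens.ι_appLE]
  have : U.ι ''ᵁ ⊤ = U := by simp
  have : IsIso (homOfLE this.le) := ⟨homOfLE this.ge, Subsingleton.elim _ _, Subsingleton.elim _ _⟩
  exact inferInstanceAs (IsIso (Z.presheaf.map (homOfLE _).op))

lemma map_ideal_injective_of_isIso {R S : CommRingCat.{u}} (φ : R ⟶ S) [IsIso φ] :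
    Function.Injective (Ideal.map φ.hom) := fun I J h => by
  have h1 (K : Ideal R) : (K.map φ.hom).comap φ.hom = K :=
    Ideal.comap_map_of_bijective _ (ConcreteCategory.bijective_of_isIso φ)
  rw [← h1 I, ← h1 J, h]

/-- The inverse image ideal sheaf on affine opens is the extension of the ideal. -/
lemma ideal_comap (I : Z.IdealSheafData) (f : Y ⟶ Z) (U : Z.affineOpens) (V : Y.affineOpens)
    (h : V.1 ≤ f ⁻¹ᵁ U.1) : (I.comap f).ideal V = (I.ideal U).map (f.appLE U V h).hom := by
  have : IsAffine U.1.toScheme := U.2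
  have : IsAffine V.1.toScheme := V.2
  -- Restricting `f` to `V ⟶ U` reduces to the affine case; the isomorphism from `Γ(Y, V)` to the
  -- global sections of `V` is cancelled at the end.
  have h1 := ideal_comap_ι_top (I.comap f) V
  rw [← Scheme.IdealSheafData.comap_comp, ← Scheme.Hom.resLE_comp_ι f h,
    Scheme.IdealSheafData.comap_comp, ideal_comap_top_of_isAffine, ideal_comap_ι_top,
    Ideal.map_map, ← CommRingCat.hom_comp] at h1
  have h2 : U.1.ι.appLE U.1 ⊤ (by simp) ≫ (f.resLE U.1 V.1 h).appTop =
      f.appLE U.1 V.1 h ≫ V.1.ι.appLE V.1 ⊤ (by simp) := by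
    rw [Scheme.Hom.appLE_comp_appLE]
    have h3 : (f.resLE U.1 V.1 h).appTop = (f.resLE U.1 V.1 h).appLE ⊤ ⊤ (Opens.map_top _).ge :=
      Scheme.Hom.app_eq_appLE _
    rw [h3, Scheme.Hom.appLE_comp_appLE]
    simp only [Scheme.Hom.resLE_comp_ι]
  rw [h2, CommRingCat.hom_comp, ← Ideal.map_map] at h1
  exact map_ideal_injective_of_isIso _ h1.symm

/-- These are the opens to which `ideal_comap` applies, so identities between inverse image ideals
may be checked on them. -/
lemma iSup_affineOpens_le_preimage (f : Y ⟶ Z) :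
    ⨆ V : {V : Y.affineOpens // ∃ U : Z.affineOpens, V.1 ≤ f ⁻¹ᵁ U.1}, V.1.1 = ⊤ := by
  rw [eq_top_iff]
  intro y _
  obtain ⟨_, ⟨U, hU, rfl⟩, hyU, -⟩ :=
    Z.isBasis_affineOpens.exists_subset_of_mem_open (Set.mem_univ (f y)) isOpen_univ
  obtain ⟨_, ⟨V, hV, rfl⟩, hyV, hVU⟩ :=
    Y.isBasis_affineOpens.exists_subset_of_mem_open (show y ∈ f ⁻¹ᵁ U from hyU) (f ⁻¹ᵁ U).2
  exact Opens.mem_iSup.mpr ⟨⟨⟨V, hV⟩, ⟨U, hU⟩, hVU⟩, hyV⟩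

lemma comap_mul (I J : Z.IdealSheafData) (f : Y ⟶ Z) :
    (I * J).comap f = I.comap f * J.comap f := by
  refine Scheme.IdealSheafData.ext_of_iSup_eq_top _ (iSup_affineOpens_le_preimage f) ?_
  rintro ⟨V, U, h⟩
  simp only [Scheme.IdealSheafData.ideal_mul, Pi.mul_apply]
  rw [ideal_comap _ f U V h, ideal_comap _ f U V h, ideal_comap _ f U V h,
      Scheme.IdealSheafData.ideal_mul, Pi.mul_apply, Ideal.map_mul]

lemma comap_prod {ι : Type*} (s : Finset ι) (I : ι → Z.IdealSheafData) (f : Y ⟶ Z) :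
    (∏ i ∈ s, I i).comap f = ∏ i ∈ s, (I i).comap f :=
  map_prod (⟨⟨(·.comap f), Scheme.IdealSheafData.comap_top f⟩, fun I J => comap_mul I J f⟩ :
    Z.IdealSheafData →* Y.IdealSheafData) I s

lemma comap_pow (I : Z.IdealSheafData) (f : Y ⟶ Z) (n : ℕ) :
    (I ^ n).comap f = I.comap f ^ n := by
  simpa using comap_prod (Finset.range n) (fun _ => I) f

end IdealSheaf

/-! ### Pullback and comparison of effective Cartier divisors. -/

section Cartier

variable {Y Z : Scheme.{u}}

/-- An effective Cartier divisor pulls back to an effective Cartier divisor on an integral scheme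
whose image is not contained in its support. -/
lemma IsEffectiveCartier.comap [IsIntegral Y] {f : Y ⟶ Z} {D : Z.IdealSheafData}
    (hD : IsEffectiveCartier D) {y₀ : Y} (hy₀ : f y₀ ∉ D.support) :
    IsEffectiveCartier (D.comap f) := by
  intro y
  obtain ⟨U, hyU, s, hs, hDs⟩ := hD (f y)
  obtain ⟨_, ⟨V, hV, rfl⟩, hyV, hVU⟩ :=
    Y.isBasis_affineOpens.exists_subset_of_mem_open (show y ∈ f ⁻¹ᵁ U.1 from hyU) (f ⁻¹ᵁ U.1).2
  have : Nonempty V := ⟨⟨y, hyV⟩⟩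
  have hideal : (D.comap f).ideal ⟨V, hV⟩ = Ideal.span {f.appLE U V hVU s} := by
    rw [ideal_comap D f U ⟨V, hV⟩ hVU, hDs, Ideal.map_span, Set.image_singleton]
  refine ⟨⟨V, hV⟩, hyV, _, ?_, hideal⟩
  rw [mem_nonZeroDivisors_iff_ne_zero]
  intro h0
  -- If the local equation vanished on `V`, the closed support would contain the dense open `V`,
  -- hence also `y₀`.
  have hsub : (V : Set Y) ⊆ (D.comap f).support := fun x hx => by
    rw [SetLike.mem_coe, Scheme.IdealSheafData.mem_support_iff_of_mem (U := ⟨V, hV⟩) hx, hideal, h0]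
    simp
  have hy : y₀ ∈ (D.comap f).support :=
    (D.comap f).support.isClosed.closure_subset_iff.mpr hsub
      ((V.2.dense ⟨y, hyV⟩).closure_eq ▸ Set.mem_univ y₀)
  rw [Scheme.IdealSheafData.support_comap] at hy
  exact hy₀ hy

/-- On a quasi-compact scheme, an effective Cartier divisor is bounded by a multiple of any effective
Cartier divisor with larger support. -/
lemma IsEffectiveCartier.exists_pow_le [CompactSpace Y] {D E : Y.IdealSheafData}
    (hE : IsEffectiveCartier E) (h : D.support ≤ E.support) : ∃ m : ℕ, E ^ (m + 1) ≤ D := by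
  choose U hyU s _ hs using hE
  obtain ⟨t, ht⟩ := isCompact_univ.elim_finite_subcover (fun y => (U y).1.1)
    (fun y => (U y).1.2) (fun y _ => Set.mem_iUnion.mpr ⟨y, hyU y⟩)
  have hrad : ∀ y, ∃ m : ℕ, s y ^ m ∈ D.ideal (U y) := by
    intro y
    -- Larger support means smaller radical, so each local equation of `E` has a power in the ideal
    -- of `D`.
    have h1 : E ≤ D.radical := by
      rw [← Scheme.IdealSheafData.vanishingIdeal_support]
      exact Scheme.IdealSheafData.le_support_iff_le_vanishingIdeal.mp h
    have h2 := h1 (U y) (x := s y) (by rw [hs]; exact Ideal.mem_span_singleton_self _)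
    exact h2
  choose m hm using hrad
  -- The largest exponent over a finite subcover; the extra `+ 1` only keeps the multiple positive.
  refine ⟨t.sup m, Scheme.IdealSheafData.le_of_iSup_eq_top (fun y : t => U y) ?_ fun y => ?_⟩
  · rw [eq_top_iff]
    intro y hy
    obtain ⟨z, hz, hyz⟩ := Set.mem_iUnion₂.mp (ht (Set.mem_univ y))
    exact Opens.mem_iSup.mpr ⟨⟨z, hz⟩, hyz⟩
  · rw [Scheme.IdealSheafData.ideal_pow, Pi.pow_apply, hs, Ideal.span_singleton_pow,
      Ideal.span_singleton_le_iff_mem]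
    exact Ideal.pow_mem_of_pow_mem _ (hm y) ((Finset.le_sup y.2).trans (Nat.le_succ _))

end Cartier

/-! ### Integral functions and the descent of divisor inequalities to a normalization. -/

/-- If `g / d` is integral over `A` in some extension of `A`, it is so in any domain. -/
lemma isIntegralElem_of_mul_eq {A C K : Type*} [CommRing A] [CommRing C] [CommRing K] [IsDomain K]
    (φ : A →+* C) (hφ : Function.Injective φ) (ψ : A →+* K) {g d : A} (hd : ψ d ≠ 0) {x : C}
    (hx : φ.IsIntegralElem x) (hg : φ g = φ d * x) {y : K} (hy : ψ g = ψ d * y) :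
    ψ.IsIntegralElem y := by
  obtain ⟨p, hp, hpx⟩ := hx
  refine ⟨p, hp, ?_⟩
  -- Clearing denominators turns `p(g / d) = 0` into a relation between `g` and `d`, which holds in
  -- `A` by injectivity of `φ`. Its image under `ψ` gives the same equation for `y` after cancelling
  -- a power of `ψ d`.
  have h1 := Polynomial.scaleRoots_eval₂_mul (p := p) φ x d
  rw [hpx, mul_zero, ← hg, Polynomial.eval₂_hom, map_eq_zero_iff _ hφ] at h1
  have h2 := Polynomial.scaleRoots_eval₂_mul (p := p) ψ y d
  rw [← hy, Polynomial.eval₂_hom, h1, map_zero] at h2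
  exact (mul_eq_zero.mp h2.symm).resolve_left (pow_ne_zero _ hd)

/-- The statement for global sections over an affine base, applied to the restriction of `p` over
`U`. It makes a quotient that is regular upstairs integral downstairs. -/
lemma isIntegral_app_of_universallyClosed {P W : Scheme.{u}} (p : P ⟶ W) [UniversallyClosed p]
    {U : W.Opens} (hU : IsAffineOpen U) : (p.app U).hom.IsIntegral := by
  have : IsAffine U.toScheme := hU
  have h1 := isIntegral_appTop_of_universallyClosed (p ∣_ U)
  have h2 : U.ι.appLE U ⊤ (by simp) ≫ (p ∣_ U).appTop =
      p.app U ≫ (p ⁻¹ᵁ U).ι.appLE (p ⁻¹ᵁ U) ⊤ (by simp) := by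
    have h3 : (p ∣_ U).appTop = (p ∣_ U).appLE ⊤ ⊤ (Opens.map_top _).ge :=
      Scheme.Hom.app_eq_appLE _
    rw [h3, Scheme.Hom.appLE_comp_appLE, Scheme.Hom.app_eq_appLE, Scheme.Hom.appLE_comp_appLE]
    simp only [morphismRestrict_ι]
  have h4 : (U.ι.appLE U ⊤ (by simp) ≫ (p ∣_ U).appTop).hom.IsIntegral :=
    RingHom.IsIntegral.trans _ _ (RingHom.isIntegral_of_surjective _
      (ConcreteCategory.bijective_of_isIso (U.ι.appLE U ⊤ _)).2) h1
  rw [h2] at h4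
  intro x
  obtain ⟨q, hq, hqx⟩ := h4 ((p ⁻¹ᵁ U).ι.appLE (p ⁻¹ᵁ U) ⊤ (Scheme.Opens.ι_preimage_self _).ge x)
  refine ⟨q, hq, ?_⟩
  rw [CommRingCat.hom_comp] at hqx
  apply (ConcreteCategory.bijective_of_isIso
    ((p ⁻¹ᵁ U).ι.appLE (p ⁻¹ᵁ U) ⊤ (Scheme.Opens.ι_preimage_self _).ge)).1
  rw [map_zero]
  exact (Polynomial.hom_eval₂ _ _ _ _).trans hqx

lemma isField_Γ_of_nonempty {K : CommRingCat.{u}} (hK : IsField K) (V : (Spec K).Opens)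
    [hV : Nonempty V] : IsField Γ(Spec K, V) := by
  let := hK.toField
  have : V = ⊤ := by
    obtain ⟨v⟩ := hV
    rw [eq_top_iff]
    intro z _
    rw [show z = v.1 from Subsingleton.elim (α := PrimeSpectrum K) _ _]
    exact v.2
  subst this
  exact (Scheme.ΓSpecIso K).commRingCatIsoToRingEquiv.toMulEquiv.isField hK

section Normalization

variable {W W' : Scheme.{u}} [IsIntegral W] [IsIntegral W']

instance isDominant_fromSpecStalk_genericPoint :
    IsDominant (W.fromSpecStalk (genericPoint W)) where
  denseRange := by
    refine ((dense_iff_closure_eq.mpr (genericPoint_closure W)).mono ?_)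
    rw [Set.singleton_subset_iff, Scheme.range_fromSpecStalk]
    exact specializes_rfl

instance : IsIntegral (normalization W) := by
  have : IsIntegral (Spec (W.presheaf.stalk (genericPoint W))) :=
    inferInstanceAs (IsIntegral (Spec (W.functionField)))
  unfold normalization
  infer_instance

instance : IsIntegralHom (normalizationMap W) :=
  inferInstanceAs (IsIntegralHom (W.fromSpecStalk (genericPoint W)).fromNormalization)

/-- The generic point of the normalization. -/
noncomputable def genericToNormalization (W : Scheme.{u}) [IsIntegral W] :
    Spec (W.presheaf.stalk (genericPoint W)) ⟶ normalization W :=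
  (W.fromSpecStalk (genericPoint W)).toNormalization

lemma genericToNormalization_comp :
    genericToNormalization W ≫ normalizationMap W = W.fromSpecStalk (genericPoint W) :=
  Scheme.Hom.toNormalization_fromNormalization _

instance : IsDominant (normalizationMap W) := by
  have : IsDominant (genericToNormalization W ≫ normalizationMap W) := by
    rw [genericToNormalization_comp]
    infer_instance
  exact IsDominant.of_comp (genericToNormalization W) _

/-- The normalization is functorial for dominant morphisms. -/
lemma exists_normalization_lift (w : W' ⟶ W) [IsDominant w] :
    ∃ q : normalization W' ⟶ normalization W,
      q ≫ normalizationMap W = normalizationMap W' ≫ w := by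
  have h1 : w (genericPoint W') = genericPoint W := by
    refine ((genericPoint_spec W).eq ?_).symm
    have h := (genericPoint_spec W').image w.continuous
    rwa [Set.image_univ, w.denseRange.closure_range] at h
  let a : Spec (W'.presheaf.stalk (genericPoint W')) ⟶ Spec (W.presheaf.stalk (genericPoint W)) :=
    Spec.map (w.stalkMap (genericPoint W')) ≫
      Spec.map (W.presheaf.stalkSpecializes (specializes_of_eq h1))
  have ha : a ≫ W.fromSpecStalk _ = W'.fromSpecStalk _ ≫ w := by
    simp [a]
  let b := pullback.lift (f := w) (g := normalizationMap W) (W'.fromSpecStalk (genericPoint W'))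
    (a ≫ genericToNormalization W) (by
      rw [Category.assoc, genericToNormalization_comp, ha])
  -- The base change of `normalizationMap W` along `w` is integral and receives the generic point of
  -- `W'`, so the universal property of `normalization W'` applies.
  let c : normalization W' ⟶ pullback w (normalizationMap W) :=
    (W'.fromSpecStalk (genericPoint W')).normalizationDesc b (pullback.fst w (normalizationMap W))
      (pullback.lift_fst _ _ _).symm
  have hc : c ≫ pullback.fst w (normalizationMap W) = normalizationMap W' :=
    Scheme.Hom.normalizationDesc_comp ..
  exact ⟨c ≫ pullback.snd _ _, by rw [Category.assoc, ← pullback.condition, reassoc_of% hc]⟩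

/-- A section that is locally a multiple of `d` is a multiple of `d`. -/
lemma exists_mul_eq_of_locally {U : W.Opens} {g d : Γ(W, U)} (hd : d ≠ 0)
    (h : ∀ z ∈ U, ∃ (V : W.Opens) (hV : V ≤ U), z ∈ V ∧
      ∃ x, W.presheaf.map (homOfLE hV).op g = W.presheaf.map (homOfLE hV).op d * x) :
    ∃ x, g = d * x := by
  choose V hV hzV x hx using h
  -- On an integral scheme `d` stays nonzero on nonempty opens, so the local quotients are unique
  -- and glue; over an empty overlap there is nothing to compare.
  have hcompat : TopCat.Presheaf.IsCompatible W.presheaf (fun z : U => V z.1 z.2)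
      (fun z => x z.1 z.2) := by
    intro z z'
    by_cases hne : Nonempty ((V z.1 z.2 ⊓ V z'.1 z'.2 : W.Opens))
    · have hd' : W.presheaf.map (homOfLE (inf_le_left.trans (hV z.1 z.2) :
          V z.1 z.2 ⊓ V z'.1 z'.2 ≤ U)).op d ≠ 0 := by
        rw [Ne, map_eq_zero_iff _ (map_injective_of_isIntegral _ _)]
        exact hd
      apply mul_left_cancel₀ hd'
      have e1 := congrArg (W.presheaf.map (homOfLE (inf_le_left :
        V z.1 z.2 ⊓ V z'.1 z'.2 ≤ V z.1 z.2)).op) (hx z.1 z.2)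
      have e2 := congrArg (W.presheaf.map (homOfLE (inf_le_right :
        V z.1 z.2 ⊓ V z'.1 z'.2 ≤ V z'.1 z'.2)).op) (hx z'.1 z'.2)
      rw [map_mul, ← ConcreteCategory.comp_apply, ← ConcreteCategory.comp_apply,
        ← Functor.map_comp, ← op_comp] at e1 e2
      exact e1.symm.trans e2
    · have : (V z.1 z.2 ⊓ V z'.1 z'.2 : W.Opens) = ⊥ := by
        rw [← not_ne_iff, Opens.ne_bot_iff_nonempty]
        exact fun ⟨y, hy⟩ => hne ⟨⟨y, hy⟩⟩
      have : Subsingleton Γ(W, V z.1 z.2 ⊓ V z'.1 z'.2) := by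
        rw [this]; infer_instance
      exact Subsingleton.elim _ _
  obtain ⟨y, hy, -⟩ := W.sheaf.existsUnique_gluing' (fun z : U => V z.1 z.2) U
    (fun z => homOfLE (hV z.1 z.2))
    (fun z hz => Opens.mem_iSup.mpr ⟨⟨z, hz⟩, hzV z hz⟩) _ hcompat
  refine ⟨y, W.sheaf.eq_of_locally_eq' (fun z : U => V z.1 z.2) U
    (fun z => homOfLE (hV z.1 z.2)) (fun z hz => Opens.mem_iSup.mpr ⟨⟨z, hz⟩, hzV z hz⟩) _ _
    fun z => ?_⟩
  have h1 := hy z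
  have h2 := hx z.1 z.2
  rw [← h1] at h2
  exact h2.trans (map_mul _ _ _).symm

/-- On a normalization, containment of an ideal sheaf in the ideal of an effective Cartier divisor
may be checked after pullback to a dominant universally closed integral scheme. -/
lemma comap_normalizationMap_le {P : Scheme.{u}} [IsIntegral P] (p : P ⟶ W) [UniversallyClosed p]
    [IsDominant p] {I J : W.IdealSheafData} (hI : IsEffectiveCartier I)
    (h : J.comap p ≤ I.comap p) :
    J.comap (normalizationMap W) ≤ I.comap (normalizationMap W) := by
  choose U hU d hd hId using hI
  refine Scheme.IdealSheafData.le_of_iSup_eq_top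
    (fun z => ⟨normalizationMap W ⁻¹ᵁ (U z).1, (U z).2.preimage _⟩) ?_ fun z => ?_
  · rw [eq_top_iff]
    exact fun y _ => Opens.mem_iSup.mpr ⟨normalizationMap W y, hU _⟩
  have : Nonempty (U z).1 := ⟨⟨z, hU z⟩⟩
  have hd0 : d z ≠ 0 := nonZeroDivisors.ne_zero (hd z)
  rw [ideal_comap J _ (U z) _ le_rfl, ideal_comap I _ (U z) _ le_rfl, hId, Ideal.map_span,
    Set.image_singleton, Ideal.map_le_iff_le_comap]
  intro g hg
  rw [Ideal.mem_comap, Ideal.mem_span_singleton]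
  have : IsSchemeTheoreticallyDominant p := .of_isDominant p
  -- The local quotients `g / d` given by `h` glue to a function `x` on the whole of `p ⁻¹ᵁ U z`;
  -- integrality is available only for such functions.
  obtain ⟨x, hx⟩ : ∃ x, p.app (U z) g = p.app (U z) (d z) * x := by
    refine exists_mul_eq_of_locally ?_ fun y hy => ?_
    · rwa [Ne, map_eq_zero_iff _ (p.app_injective _)]
    obtain ⟨_, ⟨V, hV, rfl⟩, hyV, hVU⟩ :=
      P.isBasis_affineOpens.exists_subset_of_mem_open hy (p ⁻¹ᵁ (U z).1).2
    have h1 := h ⟨V, hV⟩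
    rw [ideal_comap J _ (U z) _ hVU, ideal_comap I _ (U z) _ hVU, hId, Ideal.map_span,
      Set.image_singleton, Ideal.map_le_iff_le_comap] at h1
    obtain ⟨x, hx⟩ := Ideal.mem_span_singleton.mp (Ideal.mem_comap.mp (h1 hg))
    exact ⟨V, hVU, hyV, x, hx⟩
  let f := W.fromSpecStalk (genericPoint W)
  have hf : IsSchemeTheoreticallyDominant f := .of_isDominant f
  have hne : Nonempty (f ⁻¹ᵁ (U z).1) := by
    obtain ⟨y, hy⟩ := f.denseRange.exists_mem_open (U z).1.2 ⟨z, hU z⟩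
    exact ⟨⟨y, hy⟩⟩
  -- The sections here are the function field of `W`, where `g / d` exists as `e * g`.
  have hK : IsField Γ(Spec (W.presheaf.stalk (genericPoint W)), f ⁻¹ᵁ (U z).1) :=
    isField_Γ_of_nonempty (Field.toIsField W.functionField) _
  have := hK.isDomain
  have hd1 : f.app (U z) (d z) ≠ 0 := by
    rwa [Ne, map_eq_zero_iff _ (f.app_injective _)]
  obtain ⟨e, he⟩ := hK.mul_inv_cancel hd1
  have hy : f.app (U z) g = f.app (U z) (d z) * (e * f.app (U z) g) := by
    rw [← mul_assoc, he, one_mul]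
  have hint := isIntegralElem_of_mul_eq (p.app (U z)).hom (p.app_injective _) (f.app (U z)).hom hd1
    (isIntegral_app_of_universallyClosed p (U z).2 x) hx hy
  let := (f.app (U z)).hom.toAlgebra
  have h3 : (normalizationMap W).appLE (U z).1 (normalizationMap W ⁻¹ᵁ (U z).1) le_rfl =
      CommRingCat.ofHom (algebraMap _ _) ≫ (f.normalizationObjIso (U z).2).inv :=
    (Scheme.Hom.app_eq_appLE _).symm.trans (f.fromNormalization_app (U z).2)
  rw [h3]
  -- `B` is the ring of the normalization over `U z`; `hint` places `g / d` in it, so `d` divides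
  -- `g` there.
  let B := integralClosure Γ(W, U z) Γ(Spec (W.presheaf.stalk (genericPoint W)), f ⁻¹ᵁ (U z).1)
  refine map_dvd (f.normalizationObjIso (U z).2).inv.hom (a := algebraMap _ B (d z))
    (b := algebraMap _ B g) ⟨⟨_, hint⟩, ?_⟩
  exact Subtype.ext hy

end Normalization

/-! ### Closures of `V` in different ambient schemes. -/

section Closure

variable {Y Z Z' : Scheme.{u}} (V : IntegralClosedSubscheme Y) (g' : Y ⟶ Z') (F : Z' ⟶ Z)

lemma coe_support_closureIn (g : Y ⟶ Z) :
    ((V.closureIn g).ideal.support : Set Z) = closure (g '' (V.ideal.support : Set Y)) := by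
  exact Scheme.IdealSheafData.coe_support_vanishingIdeal _

lemma mem_support_closureIn (g : Y ⟶ Z) {v : Y} (hv : v ∈ V.ideal.support) :
    g v ∈ (V.closureIn g).ideal.support := by
  rw [← SetLike.mem_coe, coe_support_closureIn]
  exact subset_closure ⟨v, hv, rfl⟩

lemma map_ideal_closureIn : (V.closureIn g').ideal.map F = (V.closureIn (g' ≫ F)).ideal := by
  change (Scheme.IdealSheafData.vanishingIdeal _).map F = Scheme.IdealSheafData.vanishingIdeal _
  rw [Scheme.IdealSheafData.map_vanishingIdeal]
  congr 1
  ext1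
  simp only [Closeds.coe_closure, Scheme.Hom.comp_base, TopCat.coe_comp, Set.image_comp]
  exact closure_image_closure F.continuous

/-- A closed map commutes with closure. This yields both the surjectivity of `closureInMap` and the
comparison of the conditions on meeting `D`. -/
lemma image_support_closureIn [UniversallyClosed F] :
    F '' ((V.closureIn g').ideal.support : Set Z') = (V.closureIn (g' ≫ F)).ideal.support := by
  rw [coe_support_closureIn, coe_support_closureIn,
    ← F.isClosedMap.closure_image_eq_of_continuous F.continuous, Scheme.Hom.comp_base,
    TopCat.coe_comp, Set.image_comp]

/-- The morphism between closures induced by a morphism of the ambient schemes. -/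
noncomputable def closureInMap :
    (V.closureIn g').ideal.subscheme ⟶ (V.closureIn (g' ≫ F)).ideal.subscheme :=
  Scheme.IdealSheafData.subschemeMap _ _ F (map_ideal_closureIn V g' F).ge

lemma closureInMap_ι : closureInMap V g' F ≫ (V.closureIn (g' ≫ F)).ideal.subschemeι =
    (V.closureIn g').ideal.subschemeι ≫ F :=
  Scheme.IdealSheafData.subschemeMap_subschemeι ..

instance [UniversallyClosed F] : UniversallyClosed (closureInMap V g' F) := by
  have : UniversallyClosed
      (closureInMap V g' F ≫ (V.closureIn (g' ≫ F)).ideal.subschemeι) := by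
    rw [closureInMap_ι]
    infer_instance
  exact .of_comp_of_isSeparated _ (V.closureIn (g' ≫ F)).ideal.subschemeι

instance [UniversallyClosed F] : Surjective (closureInMap V g' F) where
  surj z := by
    have h1 : (V.closureIn (g' ≫ F)).ideal.subschemeι z ∈
        ((V.closureIn (g' ≫ F)).ideal.support : Set Z) := by
      rw [← Scheme.IdealSheafData.range_subschemeι]
      exact ⟨z, rfl⟩
    rw [← image_support_closureIn, ← Scheme.IdealSheafData.range_subschemeι] at h1
    obtain ⟨_, ⟨y, rfl⟩, hy⟩ := h1
    refine ⟨y, (V.closureIn (g' ≫ F)).ideal.subschemeι.isEmbedding.injective ?_⟩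
    rw [← hy, ← Scheme.Hom.comp_apply, closureInMap_ι, Scheme.Hom.comp_apply]

/-- An inequality of pullbacks to the normalization of the closure of `V` does not change when the
ambient scheme is replaced by one mapping to it by a universally closed morphism. -/
lemma comap_normalization_closureIn_le_iff [UniversallyClosed F] {g : Y ⟶ Z} (hg : g' ≫ F = g)
    {I J : Z.IdealSheafData}
    (hI : IsEffectiveCartier (I.comap (V.closureIn g).ideal.subschemeι)) :
    (J.comap F).comap (normalizationMap _ ≫ (V.closureIn g').ideal.subschemeι) ≤
      (I.comap F).comap (normalizationMap _ ≫ (V.closureIn g').ideal.subschemeι) ↔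
    J.comap (normalizationMap _ ≫ (V.closureIn g).ideal.subschemeι) ≤
      I.comap (normalizationMap _ ≫ (V.closureIn g).ideal.subschemeι) := by
  subst hg
  -- Pullbacks to the upper normalization factor through the lower closure, so both sides concern
  -- ideal sheaves on the lower closure.
  have hcomp (I : Z.IdealSheafData) :
      (I.comap F).comap (normalizationMap _ ≫ (V.closureIn g').ideal.subschemeι) =
        (I.comap (V.closureIn (g' ≫ F)).ideal.subschemeι).comap
          (normalizationMap _ ≫ closureInMap V g' F) := by
    rw [← Scheme.IdealSheafData.comap_comp, ← Scheme.IdealSheafData.comap_comp, Category.assoc,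
      Category.assoc, closureInMap_ι]
  rw [hcomp, hcomp]
  constructor
  -- Descent: the upper normalization, universally closed and dominant over the lower closure, plays
  -- the role of `P`.
  · intro h
    rw [Scheme.IdealSheafData.comap_comp, Scheme.IdealSheafData.comap_comp I]
    exact comap_normalizationMap_le _ hI h
  -- Ascent: pull back along the map of normalizations.
  · intro h
    rw [Scheme.IdealSheafData.comap_comp J, Scheme.IdealSheafData.comap_comp I] at h
    obtain ⟨q, hq⟩ := exists_normalization_lift (closureInMap V g' F)
    rw [← hq, Scheme.IdealSheafData.comap_comp, Scheme.IdealSheafData.comap_comp _ q]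
    exact Scheme.IdealSheafData.comap_mono _ h

end Closure

/-! ### Products with `(ℙ¹)ⁿ` and invariance of the modulus condition. -/

section Cube

variable {k : Type u} [Field k]

/-- Base change of `Y' ⟶ Y` to `Y' × Pⁿ ⟶ Y × Pⁿ`. -/
noncomputable def cubeBaseChange {Y Y' : Over (base k)} (f : Y' ⟶ Y) (P : Over (base k)) (n : ℕ) :
    cubeProd Y' P n ⟶ cubeProd Y P n :=
  prod.map f (𝟙 _)

variable {Y Y' : Over (base k)} (f : Y' ⟶ Y) (P : Over (base k)) (n : ℕ)

/-- Used to transfer universal closedness from `f` to the products and to identify the pullback of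
`divisorTimes`. -/
lemma isPullback_cubeBaseChange :
    IsPullback (prod.fst : cubeProd Y' P n ⟶ Y').left (cubeBaseChange f P n).left f.left
      (prod.fst : cubeProd Y P n ⟶ Y).left :=
  (IsPullback.of_prod_fst_with_id f (∏ᶜ fun _ : Fin n => P)).map (Over.forget _)

lemma universallyClosed_cubeBaseChange [UniversallyClosed f.left] :
    UniversallyClosed (cubeBaseChange f P n).left :=
  MorphismProperty.of_isPullback (isPullback_cubeBaseChange f P n) ‹_›

lemma cubeBaseChange_coord (i : Fin n) : cubeBaseChange f P n ≫ coord Y P n i = coord Y' P n i := by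
  simp [cubeBaseChange, coord]

lemma cubeMap_cubeBaseChange {X : Over (base k)} {τ' : X ⟶ Y'} {τ : X ⟶ Y} (h : τ' ≫ f = τ)
    {B : Over (base k)} (g : B ⟶ P) :
    cubeMap τ' g n ≫ cubeBaseChange f P n = cubeMap τ g n := by
  simp [cubeMap, cubeBaseChange, h]

lemma divisorTimes_comap (D : Y.left.IdealSheafData) :
    (divisorTimes Y D n).comap (cubeBaseChange f (P1 k) n).left =
      divisorTimes Y' (D.comap f.left) n := by
  rw [divisorTimes, divisorTimes, ← Scheme.IdealSheafData.comap_comp,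
    ← Scheme.IdealSheafData.comap_comp, (isPullback_cubeBaseChange f (P1 k) n).w]

lemma divisorAtOne_comap :
    (divisorAtOne Y n).comap (cubeBaseChange f (P1 k) n).left = divisorAtOne Y' n := by
  rw [divisorAtOne, divisorAtOne, comap_prod]
  refine Finset.prod_congr rfl fun i _ => ?_
  rw [← Scheme.IdealSheafData.comap_comp, ← Over.comp_left, cubeBaseChange_coord]

/-- The set of cycles with modulus does not change under modification of the compactification. -/
lemma modulusCycles_comap {X : Over (base k)} {τ' : X ⟶ Y'} {τ : X ⟶ Y} (h : τ' ≫ f = τ)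
    [UniversallyClosed f.left] {D : Y.left.IdealSheafData} (hD : IsEffectiveCartier D)
    (hsupp : (D.support : Set Y.left) ⊆ (Set.range τ.left)ᶜ) (r : ℕ) :
    modulusCycles τ D r n = modulusCycles τ' (D.comap f.left) r n := by
  have := universallyClosed_cubeBaseChange f (P1 k) n
  ext V
  have hcl : closureInP1 τ V =
      V.closureIn ((cubeMap τ' (boxι k) n).left ≫ (cubeBaseChange f (P1 k) n).left) := by
    rw [← Over.comp_left, cubeMap_cubeBaseChange f (P1 k) n h]
    rfl
  have himage := image_support_closureIn V (cubeMap τ' (boxι k) n).left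
    (cubeBaseChange f (P1 k) n).left
  rw [← hcl] at himage
  have hmeet : (((closureInP1 τ' V).ideal.support : Set (cubeProd Y' (P1 k) n).left) ∩
        (divisorTimes Y' (D.comap f.left) n).support).Nonempty ↔
      (((closureInP1 τ V).ideal.support : Set (cubeProd Y (P1 k) n).left) ∩
        (divisorTimes Y D n).support).Nonempty := by
    rw [← himage, Set.image_inter_nonempty_iff, ← divisorTimes_comap,
      Scheme.IdealSheafData.support_comap]
    rfl
  -- A point of `V` projects into `X`, hence outside `D`; so the closure of `V` is not contained in
  -- `D × (ℙ¹)ⁿ`.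
  have hcart : IsEffectiveCartier ((divisorTimes Y D n).comap
      (closureInP1 τ V).ideal.subschemeι) := by
    obtain ⟨v, hv⟩ := V.isIrreducible_support.nonempty
    have hv' := mem_support_closureIn V (cubeMap τ (boxι k) n).left hv
    rw [← SetLike.mem_coe, ← Scheme.IdealSheafData.range_subschemeι] at hv'
    obtain ⟨y, (hy : (closureInP1 τ V).ideal.subschemeι y = _)⟩ := hv'
    rw [divisorTimes, ← Scheme.IdealSheafData.comap_comp]
    refine hD.comap (y₀ := y) fun hmem => hsupp hmem ?_
    refine ⟨(prod.fst : cubeProd X (box k) n ⟶ X).left v, ?_⟩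
    refine Eq.trans ?_ (congrArg (prod.fst : cubeProd Y (P1 k) n ⟶ Y).left hy.symm)
    rw [← Scheme.Hom.comp_apply, ← Scheme.Hom.comp_apply, ← Over.comp_left,
      ← Over.comp_left, cubeMap, prod.map_fst]
  have hiff : (divisorAtOne Y' n).comap (normalizedClosureMap τ' V) ≤
        (divisorTimes Y' (D.comap f.left) n).comap (normalizedClosureMap τ' V) ↔
      (divisorAtOne Y n).comap (normalizedClosureMap τ V) ≤
        (divisorTimes Y D n).comap (normalizedClosureMap τ V) := by
    rw [← divisorTimes_comap, ← divisorAtOne_comap f]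
    exact comap_normalization_closureIn_le_iff V _ _
      (congrArg Over.Hom.left (cubeMap_cubeBaseChange f (P1 k) n h (boxι k))) hcart
  change _ ∧ _ ∧ _ ↔ _ ∧ _ ∧ _
  rw [Set.disjoint_iff_inter_eq_empty, Set.disjoint_iff_inter_eq_empty,
    ← Set.not_nonempty_iff_eq_empty, ← Set.not_nonempty_iff_eq_empty, hmeet, hiff]

end Cube

/-! ### Dominating two compactifications by a third. -/

section Domination

/-- A dense section over an open subscheme `τ` of a separated morphism `p` is all of the preimage of
that open subscheme. -/
lemma preimage_range_eq_of_isDominant {X Y Z : Scheme.{u}} (i : X ⟶ Y) [IsDominant i] (p : Y ⟶ Z)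
    [IsSeparated p] {τ : X ⟶ Z} [IsOpenImmersion τ] (h : i ≫ p = τ) :
    p ⁻¹' Set.range τ = Set.range i := by
  apply subset_antisymm
  · intro y hy
    have hy' : y ∈ Set.range (pullback.fst p τ) := by
      rw [Scheme.Pullback.range_fst]
      exact hy
    obtain ⟨u, rfl⟩ := hy'
    -- Over `X`, `i` becomes a section of a separated morphism, hence has closed image; density of
    -- `i` leaves no room for a point outside it.
    let s : X ⟶ pullback p τ := pullback.lift i (𝟙 X) (by simpa using h)
    have hs : IsClosedImmersion s := by
      have : IsClosedImmersion (s ≫ pullback.snd p τ) := by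
        rw [pullback.lift_snd]
        infer_instance
      exact .of_comp s (pullback.snd p τ)
    have hs1 (x : X) : pullback.fst p τ (s x) = i x := by
      rw [← Scheme.Hom.comp_apply, pullback.lift_fst]
    by_contra hu
    have hu' : u ∈ (Set.range s)ᶜ := by
      rintro ⟨x, rfl⟩
      exact hu ⟨x, (hs1 x).symm⟩
    have hopen : IsOpen (pullback.fst p τ '' (Set.range s)ᶜ) :=
      (pullback.fst p τ).isOpenEmbedding.isOpenMap _ s.isClosedEmbedding.isClosed_range.isOpen_compl
    obtain ⟨x, o, ho, hox⟩ := i.denseRange.exists_mem_open hopen ⟨_, u, hu', rfl⟩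
    rw [← hs1] at hox
    exact ho ⟨x, ((pullback.fst p τ).isOpenEmbedding.injective hox).symm⟩
  · rintro _ ⟨x, rfl⟩
    exact ⟨x, by rw [← Scheme.Hom.comp_apply, h]⟩

/-- Functions on the image inject into functions on `X`, which gives reducedness; irreducibility
follows from density of `X`. -/
lemma isIntegral_image {X Z : Scheme.{u}} [IsIntegral X] (i : X ⟶ Z) [QuasiCompact i] :
    IsIntegral i.image := by
  have hker : i.toImage.ker = ⊥ := by
    refine Scheme.IdealSheafData.ext_of_iSup_eq_top
      (fun U : Z.affineOpens => ⟨i.imageι ⁻¹ᵁ U.1, U.2.preimage _⟩)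
      (TopologicalSpace.IsOpenCover.comap (iSup_affineOpens_eq_top _) _) fun U => ?_
    simp only [Scheme.Hom.ker_apply, Scheme.IdealSheafData.ideal_bot, Pi.bot_apply]
    rw [← RingHom.injective_iff_ker_eq_bot]
    exact i.toImage_app_injective U
  have : IsSchemeTheoreticallyDominant i.toImage := ⟨hker⟩
  have := IsSchemeTheoreticallyDominant.isReduced i.toImage
  have : IrreducibleSpace i.image := by
    rw [irreducibleSpace_def]
    change IsIrreducible Set.univ
    rw [← i.toImage.denseRange.closure_range, ← Set.image_univ]
    exact ((IrreducibleSpace.isIrreducible_univ X).image _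
      i.toImage.continuous.continuousOn).closure
  exact isIntegral_of_irreducibleSpace_of_isReduced _

variable {k : Type u} [Field k] {X : Over (base k)}

/-- The support of the pullback of a boundary divisor to a compactification dominating the given one
is the boundary. -/
lemma support_comap_eq_compl_range {Y Y' : Over (base k)} {τ : X ⟶ Y} {τ' : X ⟶ Y'}
    [IsOpenImmersion τ.left] [IsDominant τ'.left] (p : Y' ⟶ Y) [IsSeparated p.left]
    (h : τ' ≫ p = τ) {D : Y.left.IdealSheafData}
    (hD : (D.support : Set Y.left) = (Set.range τ.left)ᶜ) :
    ((D.comap p.left).support : Set Y'.left) = (Set.range τ'.left)ᶜ := by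
  have h1 : τ'.left ≫ p.left = τ.left := by rw [← Over.comp_left, h]
  rw [Scheme.IdealSheafData.support_comap, Closeds.coe_preimage, hD, Set.preimage_compl,
    preimage_range_eq_of_isDominant τ'.left p.left h1]

lemma Compactification.isEffectiveCartier_comap [Nonempty X.left] (K : Compactification X)
    {Y : Over (base k)} {τ : X ⟶ Y} (p : K.Xbar ⟶ Y) (h : K.τ ≫ p = τ) {D : Y.left.IdealSheafData}
    (hD : IsEffectiveCartier D) (hsupp : (D.support : Set Y.left) ⊆ (Set.range τ.left)ᶜ) :
    IsEffectiveCartier (D.comap p.left) := by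
  have := K.isIntegral
  let x : X.left := Classical.arbitrary _
  refine hD.comap (y₀ := K.τ.left x) fun hx => hsupp hx ⟨x, ?_⟩
  rw [← h, Over.comp_left, Scheme.Hom.comp_apply]

/-- Two compactifications are dominated by a third one, the closure of the diagonal. -/
lemma Compactification.exists_dominating [IsIntegral X.left] [QuasiCompact X.hom]
    (K K' : Compactification X) :
    ∃ (L : Compactification X) (p : L.Xbar ⟶ K.Xbar) (p' : L.Xbar ⟶ K'.Xbar),
      IsProper p.left ∧ IsProper p'.left ∧ IsDominant L.τ.left ∧
        L.τ ≫ p = K.τ ∧ L.τ ≫ p' = K'.τ := by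
  have := K.isProper
  have := K'.isProper
  have := K.isIntegral
  have := K'.isIntegral
  have := K.isOpenImmersion
  have := K'.isOpenImmersion
  let i : X.left ⟶ pullback K.Xbar.hom K'.Xbar.hom :=
    pullback.lift K.τ.left K'.τ.left (by rw [Over.w, Over.w])
  have hi1 : i ≫ pullback.fst _ _ = K.τ.left := pullback.lift_fst _ _ _
  have hi2 : i ≫ pullback.snd _ _ = K'.τ.left := pullback.lift_snd _ _ _
  -- The first projection composed with `i` is the open immersion `K.τ`, so `i` is an immersion.
  -- Being also quasi-compact, it is open in its scheme-theoretic image.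
  have himm : IsImmersion i := by
    have : IsImmersion (i ≫ pullback.fst K.Xbar.hom K'.Xbar.hom) := by
      rw [hi1]
      infer_instance
    exact .of_comp i (pullback.fst K.Xbar.hom K'.Xbar.hom)
  have hqc : QuasiCompact i := by
    have : QuasiCompact (i ≫ pullback.fst K.Xbar.hom K'.Xbar.hom ≫ K.Xbar.hom) := by
      rw [reassoc_of% hi1, Over.w]
      infer_instance
    exact .of_comp i (pullback.fst K.Xbar.hom K'.Xbar.hom ≫ K.Xbar.hom)
  have hint := isIntegral_image i
  let Y : Over (base k) := Over.mk (i.imageι ≫ pullback.fst _ _ ≫ K.Xbar.hom)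
  let p : Y ⟶ K.Xbar := Over.homMk (i.imageι ≫ pullback.fst _ _) (by simp [Y])
  let p' : Y ⟶ K'.Xbar := Over.homMk (i.imageι ≫ pullback.snd _ _) (by
    simp [Y, pullback.condition])
  let τ : X ⟶ Y := Over.homMk i.toImage (by
    simp only [Y, Over.mk_hom, Scheme.Hom.toImage_imageι_assoc, reassoc_of% hi1, Over.w])
  have hp : IsProper p.left := inferInstanceAs (IsProper (i.imageι ≫ pullback.fst _ _))
  have hp' : IsProper p'.left := inferInstanceAs (IsProper (i.imageι ≫ pullback.snd _ _))
  have hτ : IsOpenImmersion τ.left := inferInstanceAs (IsOpenImmersion i.toImage)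
  have hτ' : IsDominant τ.left := inferInstanceAs (IsDominant i.toImage)
  have hτp : τ ≫ p = K.τ := by
    ext1
    simp only [Over.comp_left, τ, p, Over.homMk_left, Scheme.Hom.toImage_imageι_assoc, hi1]
  have hτp' : τ ≫ p' = K'.τ := by
    ext1
    simp only [Over.comp_left, τ, p', Over.homMk_left, Scheme.Hom.toImage_imageι_assoc, hi2]
  obtain ⟨D, hD, hDsupp⟩ := K.exists_divisor
  refine ⟨⟨Y, τ, hint, inferInstanceAs (IsProper (i.imageι ≫ pullback.fst _ _ ≫ K.Xbar.hom)), hτ,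
    D.comap p.left, ?_, support_comap_eq_compl_range p hτp hDsupp⟩, p, p', hp, hp', hτ', hτp, hτp'⟩
  have : IsIntegral Y.left := hint
  let x : X.left := Classical.arbitrary _
  refine hD.comap (y₀ := τ.left x) fun hx => ?_
  rw [← SetLike.mem_coe, hDsupp] at hx
  refine hx ⟨x, ?_⟩
  rw [← hτp, Over.comp_left, Scheme.Hom.comp_apply]

/-- For boundary divisors `D`, `D'` of two compactifications, the modulus condition of a suitable
multiple of `D'` is stronger than that of `D`. -/
lemma Compactification.exists_modulusCycles_pow_subset [IsIntegral X.left] [QuasiCompact X.hom]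
    (K K' : Compactification X) (D : K.Divisor) (D' : K'.Divisor) :
    ∃ m : ℕ, ∀ r n, modulusCycles K'.τ (D'.1 ^ (m + 1)) r n ⊆ modulusCycles K.τ D.1 r n := by
  obtain ⟨L, p, p', hp, hp', hdom, h, h'⟩ := K.exists_dominating K'
  have := K.isOpenImmersion
  have := K'.isOpenImmersion
  have := L.isProper
  have : CompactSpace L.Xbar.left := QuasiCompact.compactSpace_of_compactSpace L.Xbar.hom
  have hE : IsEffectiveCartier (D'.1.comap p'.left) :=
    L.isEffectiveCartier_comap p' h' D'.2.1 D'.2.2.le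
  -- On `L` both pulled back divisors have support exactly the boundary of `L`.
  obtain ⟨m, hm⟩ := hE.exists_pow_le (D := D.1.comap p.left) (by
    rw [← SetLike.coe_subset_coe, support_comap_eq_compl_range p h D.2.2,
      support_comap_eq_compl_range p' h' D'.2.2])
  refine ⟨m, fun r n => ?_⟩
  rw [modulusCycles_comap p n h D.2.1 D.2.2.le r, modulusCycles_comap p' n h' (D'.2.1.pow m) (by
    rw [Scheme.IdealSheafData.support_pow_succ]
    exact D'.2.2.le) r, comap_pow]
  exact modulusCycles_mono L.τ hm r n

end Domination

/-! ### Mutually cofinal systems and their pro-objects. -/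

section Pro

variable {E : Type*} [Category E] {Q : Type*} [Category Q] [Quiver.IsThin Q] (L : Q ⥤ E)
  {I I' : Type*} [Category I] [Category I'] [IsFiltered I'] (A : I ⥤ Q) (B : I' ⥤ Q)
  [HasColimit (A ⋙ L)] [HasColimit (B ⋙ L)]

/-- At a common later stage the two maps coincide because `Q` is thin. Hence the chosen indices in
the constructions below do not matter. -/
lemma map_comp_colimit_ι_eq [IsFiltered I] {q : Q} {i i' : I} (f : q ⟶ A.obj i)
    (g : q ⟶ A.obj i') :
    L.map f ≫ colimit.ι (A ⋙ L) i = L.map g ≫ colimit.ι (A ⋙ L) i' := by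
  rw [← colimit.w (A ⋙ L) (IsFiltered.leftToMax i i'), ← colimit.w (A ⋙ L)
    (IsFiltered.rightToMax i i'), Functor.comp_map, Functor.comp_map, ← L.map_comp_assoc,
    ← L.map_comp_assoc, Subsingleton.elim (f ≫ A.map _) (g ≫ A.map _)]

lemma exists_colimit_map (h : ∀ i, ∃ i', Nonempty (A.obj i ⟶ B.obj i')) :
    ∃ φ : colimit (A ⋙ L) ⟶ colimit (B ⋙ L), ∀ i i' (f : A.obj i ⟶ B.obj i'),
      colimit.ι (A ⋙ L) i ≫ φ = L.map f ≫ colimit.ι (B ⋙ L) i' := by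
  choose t ht using h
  refine ⟨colimit.desc (A ⋙ L) ⟨_, fun i => L.map (ht i).some ≫ colimit.ι (B ⋙ L) (t i), ?_⟩, ?_⟩
  · intro i j f
    simp only [Functor.comp_map, Functor.const_obj_obj, Functor.const_obj_map, Category.comp_id]
    rw [← L.map_comp_assoc]
    exact map_comp_colimit_ι_eq L B _ _
  · intro i i' f
    rw [colimit.ι_desc]
    exact map_comp_colimit_ι_eq L B _ _

/-- Mutually cofinal filtered systems in a thin category have the same colimit. -/
lemma exists_colimit_iso [IsFiltered I] (h : ∀ i, ∃ i', Nonempty (A.obj i ⟶ B.obj i'))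
    (h' : ∀ i', ∃ i, Nonempty (B.obj i' ⟶ A.obj i)) :
    ∃ e : colimit (A ⋙ L) ≅ colimit (B ⋙ L), ∀ i i' (f : A.obj i ⟶ B.obj i'),
      colimit.ι (A ⋙ L) i ≫ e.hom = L.map f ≫ colimit.ι (B ⋙ L) i' := by
  obtain ⟨φ, hφ⟩ := exists_colimit_map L A B h
  obtain ⟨ψ, hψ⟩ := exists_colimit_map L B A h'
  refine ⟨⟨φ, ψ, colimit.hom_ext fun i => ?_, colimit.hom_ext fun i => ?_⟩, hφ⟩
  · obtain ⟨i', ⟨f⟩⟩ := h i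
    obtain ⟨i'', ⟨g⟩⟩ := h' i'
    rw [← Category.assoc, hφ i i' f, Category.assoc, hψ i' i'' g, ← L.map_comp_assoc,
      map_comp_colimit_ι_eq L A (f ≫ g) (𝟙 _)]
    simp
  · obtain ⟨i', ⟨f⟩⟩ := h' i
    obtain ⟨i'', ⟨g⟩⟩ := h i'
    rw [← Category.assoc, hψ i i' f, Category.assoc, hφ i' i'' g, ← L.map_comp_assoc,
      map_comp_colimit_ι_eq L B (f ≫ g) (𝟙 _)]
    simp

end Pro

section ProIso

variable {C : Type (u + 1)} [Category.{u} C] {J J' : Type u} [SmallCategory J] [IsCofiltered J]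
  [SmallCategory J'] [IsCofiltered J']

/-- Mutually cofinal systems in a preorder `P` define isomorphic pro-objects over any bound. -/
lemma proIsoOver_of_cofinal {P : Type*} [Preorder P] (H : P ⥤ C) (t : P) (a : J ⥤ P) (b : J' ⥤ P)
    (h : ∀ j', ∃ j, a.obj j ≤ b.obj j') (h' : ∀ j, ∃ j', b.obj j' ≤ a.obj j)
    (ha : ∀ j, a.obj j ≤ t) (hb : ∀ j', b.obj j' ≤ t)
    (α : a ⋙ H ⟶ (Functor.const J).obj (H.obj t)) (β : b ⋙ H ⟶ (Functor.const J').obj (H.obj t))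
    (hα : ∀ j, α.app j = H.map (homOfLE (ha j))) (hβ : ∀ j, β.app j = H.map (homOfLE (hb j))) :
    ProIsoOver α β := by
  -- Pro-objects are ind-objects of the opposite category, so the isomorphism is built from the
  -- colimit of `b` to that of `a` and then reversed.
  let L : Pᵒᵖ ⥤ Ind Cᵒᵖ := H.op ⋙ Ind.yoneda
  obtain ⟨e, he⟩ := exists_colimit_iso L b.op a.op
    (fun i => let ⟨j, hj⟩ := h i.unop; ⟨.op j, ⟨(homOfLE hj).op⟩⟩)
    (fun i => let ⟨j, hj⟩ := h' i.unop; ⟨.op j, ⟨(homOfLE hj).op⟩⟩)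
  refine ⟨Iso.op e, ?_⟩
  apply Quiver.Hom.unop_inj
  -- `proSystemToConst` uses arbitrary indices on both sides; they are compared through an index
  -- `j₁` below `j'`.
  let j := @Classical.arbitrary J (IsCofiltered.nonempty (C := J))
  let j' := @Classical.arbitrary J' (IsCofiltered.nonempty (C := J'))
  change (Ind.yoneda.map (β.app j').op ≫ colimit.ι (b.op ⋙ L) (.op j')) ≫ e.hom =
    Ind.yoneda.map (α.app j).op ≫ colimit.ι (a.op ⋙ L) (.op j)
  obtain ⟨j₁, hj₁⟩ := h j'
  rw [Category.assoc, he (.op j') (.op j₁) (homOfLE hj₁).op, hα, hβ]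
  change L.map (homOfLE (hb j')).op ≫ _ = L.map (homOfLE (ha j)).op ≫ _
  rw [← L.map_comp_assoc]
  exact map_comp_colimit_ι_eq L a.op _ _

end ProIso

/-! ### Cofinality of the systems of cycles with modulus. -/

section Systems

variable {k : Type u} [Field k] {X : Over (base k)}

variable (X) in
/-- A set of integral closed subschemes of `X × □ⁿ` for each `n`. -/
structure CycleFamily where
  sets : ∀ n, Set (IntegralClosedSubscheme (cubeProd X (box k) n).left)

instance : Preorder (CycleFamily X) where
  le C C' := ∀ n, C.sets n ⊆ C'.sets n
  le_refl C n := subset_refl (C.sets n)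
  le_trans _ _ _ h h' n := (h n).trans (h' n)

variable (X) in
/-- The cycle complex as a functor of the sets of cycles. -/
noncomputable def cycleComplexFunctor : CycleFamily X ⥤ ChainComplex AddCommGrpCat.{u} ℕ where
  obj C := cycleComplex C.sets
  map f := cycleComplexMap (leOfHom f)
  map_id _ := cycleComplexMap_id
  map_comp _ _ := (cycleComplexMap_comp _ _).symm

/-- The system of sets `C^r(X̄|D, n)`. -/
def modulusSets (K : Compactification X) (r : ℕ) : K.Divisor ⥤ CycleFamily X where
  obj D := ⟨modulusCycles K.τ D.1 r⟩
  map f := homOfLE (modulusCycles_mono K.τ (leOfHom f) r)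

variable [IsIntegral X.left] [QuasiCompact X.hom] (K K' : Compactification X)

lemma exists_modulusSets_le (r : ℕ) (D : K.Divisor) :
    ∃ D' : K'.Divisor, (modulusSets K' r).obj D' ≤ (modulusSets K r).obj D := by
  let D' : K'.Divisor := Classical.arbitrary _
  obtain ⟨m, hm⟩ := K.exists_modulusCycles_pow_subset K' D D'
  exact ⟨(multiples K' D').obj (.op ⟨m⟩), hm r⟩

/-- The multiples of one fixed boundary divisor are already cofinal, which makes the Chow groups
with compact support independent of its choice. -/
lemma exists_modulusSets_multiples_le (r : ℕ) (D : K.Divisor) (D' : K'.Divisor) :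
    ∃ m, (multiples K' D' ⋙ modulusSets K' r).obj m ≤ (modulusSets K r).obj D := by
  obtain ⟨m, hm⟩ := K.exists_modulusCycles_pow_subset K' D D'
  exact ⟨.op ⟨m⟩, hm r⟩

lemma proIsoOver_modulusSystem (r : ℕ) :
    ProIsoOver (modulusSystemToBloch K r) (modulusSystemToBloch K' r) :=
  proIsoOver_of_cofinal (cycleComplexFunctor X) ⟨admissibleCycles X r⟩ (modulusSets K r)
    (modulusSets K' r) (exists_modulusSets_le K' K r) (exists_modulusSets_le K K' r)
    (fun D => modulusCycles_subset K.τ D.1 r) (fun D => modulusCycles_subset K'.τ D.1 r)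
    (modulusSystemToBloch K r) (modulusSystemToBloch K' r) (fun _ => rfl) (fun _ => rfl)

lemma proIsoOver_chowSystem (r n : ℕ) :
    ProIsoOver (chowSystemToBloch K r n) (chowSystemToBloch K' r n) :=
  proIsoOver_of_cofinal
    (cycleComplexFunctor X ⋙ HomologicalComplex.homologyFunctor AddCommGrpCat.{u} _ n)
    ⟨admissibleCycles X r⟩ (modulusSets K r)
    (modulusSets K' r) (exists_modulusSets_le K' K r) (exists_modulusSets_le K K' r)
    (fun D => modulusCycles_subset K.τ D.1 r) (fun D => modulusCycles_subset K'.τ D.1 r)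
    (chowSystemToBloch K r n) (chowSystemToBloch K' r n) (fun _ => rfl) (fun _ => rfl)

lemma proIsoOver_chowCompact (D : K.Divisor) (D' : K'.Divisor) (r n : ℕ) :
    ProIsoOver (chowCompactToBloch K D r n) (chowCompactToBloch K' D' r n) :=
  proIsoOver_of_cofinal
    (cycleComplexFunctor X ⋙ HomologicalComplex.homologyFunctor AddCommGrpCat.{u} _ n)
    ⟨admissibleCycles X r⟩ (multiples K D ⋙ modulusSets K r) (multiples K' D' ⋙ modulusSets K' r)
    (fun m => exists_modulusSets_multiples_le K' K r ((multiples K' D').obj m) D)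
    (fun m => exists_modulusSets_multiples_le K K' r ((multiples K D).obj m) D')
    (fun m => modulusCycles_subset K.τ ((multiples K D).obj m).1 r)
    (fun m => modulusCycles_subset K'.τ ((multiples K' D').obj m).1 r)
    (chowCompactToBloch K D r n) (chowCompactToBloch K' D' r n) (fun _ => rfl) (fun _ => rfl)

end Systems

end CycleModulus

theorem lemma2 {k : Type u} [Field k] (X : Over (CycleModulus.base k))
    [IsIntegral X.left] [LocallyOfFiniteType X.hom] [QuasiCompact X.hom] :
    -- equality of the sets of cycles with modulus
    (∀ (K K' : CycleModulus.Compactification X) (f : K'.Xbar ⟶ K.Xbar),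
      IsProper f.left → Surjective f.left → K'.τ ≫ f = K.τ →
      ∀ D : K.Xbar.left.IdealSheafData, CycleModulus.IsEffectiveCartier D →
        (D.support : Set K.Xbar.left) ⊆ (Set.range K.τ.left)ᶜ →
        CycleModulus.IsEffectiveCartier (D.comap f.left) ∧
        ∀ r n : ℕ, CycleModulus.modulusCycles K.τ D r n =
          CycleModulus.modulusCycles K'.τ (D.comap f.left) r n) ∧
    -- independence of the compactification
    (∀ K K' : CycleModulus.Compactification X,
      (∀ r : ℕ, CycleModulus.ProIsoOver (CycleModulus.modulusSystemToBloch K r)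
        (CycleModulus.modulusSystemToBloch K' r)) ∧
      (∀ r n : ℕ, CycleModulus.ProIsoOver (CycleModulus.chowSystemToBloch K r n)
        (CycleModulus.chowSystemToBloch K' r n)) ∧
      (∀ (D : K.Divisor) (D' : K'.Divisor) (r n : ℕ),
        CycleModulus.ProIsoOver (CycleModulus.chowCompactToBloch K D r n)
          (CycleModulus.chowCompactToBloch K' D' r n))) := by
  refine ⟨fun K K' f hf _ h D hD hsupp => ?_, fun K K' =>
    ⟨CycleModulus.proIsoOver_modulusSystem K K', CycleModulus.proIsoOver_chowSystem K K',
      CycleModulus.proIsoOver_chowCompact K K'⟩⟩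
  exact ⟨K'.isEffectiveCartier_comap f h hD hsupp,
    fun r n => CycleModulus.modulusCycles_comap f n h hD hsupp r⟩
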